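/- Consider a base station with $M$ antennas and $K$ users with $N$ antennas each, with channel matrices $H_i\in\mathbb{C}^{N\times M}$, noise variance $\sigma^2>0$, bandwidth $W>0$, power amplifier efficiency $\eta>0$, dynamic power $P_{\rm dyn}$ per active antenna and static power $P_{\rm sta}$. Fix an active antenna set $\mathcal T\subseteq\{1,\dots,M\}$ with $M_a=|\mathcal T|$, let $H_{\mathcal T,i}\in\mathbb{C}^{N\times M_a}$ consist of the columns of $H_i$ indexed by $\mathcal T$, and assume that $M_aP_{\rm dyn}+P_{\rm sta}>0$ and that $H_{\mathcal T,i}\neq 0$ for every $i$. For positive semidefinite $Q_1,\dots,Q_K\in\mathbb{C}^{N\times N}$ define the energy efficiency (EE) $$g(Q_1,\dots,Q_K)=\frac{W\log_2\det\bigl(I+\frac1{\sigma^2}\sum_{i=1}^K H_{\mathcal T,i}^{H}Q_iH_{\mathcal T,i}\bigr)}{\frac1\eta\sum_{i=1}^K\operatorname{Tr}(Q_i)+M_aP_{\rm dyn}+P_{\rm sta}}.$$ Then: 1. For all positive semidefinite $Q_1,\dots,Q_K$ and every $i$, the function $A\mapsto g(Q_1,\dots,Q_{i-1},A,Q_{i+1},\dots,Q_K)$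 has exactly one maximizer over the positive semidefinite matrices $A\in\mathbb{C}^{N\times N}$. 2. Let $Q^{(0)}=(Q^{(0)}_1,\dots,Q^{(0)}_K)$ be any tuple of positive semidefinite matrices (for example all zero). Then there is exactly one sequence $Q^{(k)}$, $k\ge 0$, starting at $Q^{(0)}$ and such that for all $k\ge 0$ and $i=1,\dots,K$ $$Q_i^{(k+1)}=\arg\max_{A\succeq 0}\, g\bigl(Q_1^{(k+1)},\dots,Q_{i-1}^{(k+1)},A,Q_{i+1}^{(k)},\dots,Q_K^{(k)}\bigr).$$ For this sequence, $g$ does not decrease in any single update of one user's matrix, and hence $g(Q^{(k)})$ is non-decreasing in $k$. The iterates $Q^{(k)}$ converge to a tuple $Q^\star$ of positive semidefinite matrices, the EE values $g(Q^{(k)})$ converge to $g(Q^\star)$, and $Q^\star$ is a global maximizer of $g$ over all tuples of positive semidefinite matrices, i.e. of the unconstrained EE problem (P1). -/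

import Mathlib

open Filter Topology
open scoped ComplexOrder

noncomputable section

/-- Data of a MIMO broadcast channel with `M` base station antennas and `K` users having `N`
antennas each, together with the affine power consumption model. -/
structure MIMOBC (K N M : ℕ) where
  /-- channel matrix from the base station to each user -/
  H : Fin K → Matrix (Fin N) (Fin M) ℂ
  /-- noise standard deviation (the noise variance is `σ ^ 2`) -/
  σ : ℝ
  /-- bandwidth -/
  W : ℝ
  /-- power amplifier efficiency -/
  η : ℝ
  /-- dynamic power per active transmit antenna -/
  Pdyn : ℝ
  /-- static power -/
  Psta : ℝ

/-- A tuple `(Q₁, …, Q_K)` of candidate dual-MAC transmit covariance matrices. -/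
abbrev CovTuple (K N : ℕ) := Fin K → Matrix (Fin N) (Fin N) ℂ

namespace MIMOBC

variable {K N M : ℕ}

/-- The channel matrix of user `i` restricted to the active transmit antennas. -/
def activeH (S : MIMOBC K N M) (T : Finset (Fin M)) (i : Fin K) : Matrix (Fin N) T ℂ :=
  (S.H i).submatrix id (fun a : T => (a : Fin M))

/-- The matrix `I + σ⁻² ∑ᵢ Hᵢᴴ Qᵢ Hᵢ` of the dual multiple access channel. -/
def macMatrix (S : MIMOBC K N M) (T : Finset (Fin M)) (Q : CovTuple K N) : Matrix T T ℂ :=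
  1 + ((1 / S.σ ^ 2 : ℝ) : ℂ) •
    ∑ i, (S.activeH T i).conjTranspose * Q i * S.activeH T i

/-- The sum-rate `W log₂ |I + σ⁻² ∑ᵢ Hᵢᴴ Qᵢ Hᵢ|` (the determinant is a positive real number
whenever all `Qᵢ` are positive semidefinite). -/
def sumRate (S : MIMOBC K N M) (T : Finset (Fin M)) (Q : CovTuple K N) : ℝ :=
  S.W * Real.logb 2 (S.macMatrix T Q).det.re

/-- The transmit independent power `M_a P_dyn + P_sta`, where `M_a = |T|`. -/
def fixedPower (S : MIMOBC K N M) (T : Finset (Fin M)) : ℝ :=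
  (T.card : ℝ) * S.Pdyn + S.Psta

/-- The total power `(∑ᵢ Tr Qᵢ) / η + M_a P_dyn + P_sta`. -/
def totalPower (S : MIMOBC K N M) (T : Finset (Fin M)) (Q : CovTuple K N) : ℝ :=
  (∑ i, (Q i).trace.re) / S.η + S.fixedPower T

/-- The energy efficiency `g(Q₁, …, Q_K)`. -/
def ee (S : MIMOBC K N M) (T : Finset (Fin M)) (Q : CovTuple K N) : ℝ :=
  S.sumRate T Q / S.totalPower T Q

/-- `A` maximizes `g(Q₁, …, Q_{i-1}, ·, Q_{i+1}, …, Q_K)` over the positive semidefinite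
matrices. -/
def IsBlockMaximizer (S : MIMOBC K N M) (T : Finset (Fin M)) (i : Fin K) (Q : CovTuple K N)
    (A : Matrix (Fin N) (Fin N) ℂ) : Prop :=
  A.PosSemidef ∧ ∀ B : Matrix (Fin N) (Fin N) ℂ, B.PosSemidef →
    S.ee T (Function.update Q i B) ≤ S.ee T (Function.update Q i A)

end MIMOBC

/-- The feasible set of the unconstrained problem: all `Qᵢ` are positive semidefinite. -/
def feasibleCov (K N : ℕ) : Set (CovTuple K N) :=
  {Q | ∀ i, (Q i).PosSemidef}

/-- The state inside a sweep, after the first `m` users have been updated. -/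
def midSweep {K N : ℕ} (Qold Qnew : CovTuple K N) (m : ℕ) : CovTuple K N :=
  fun j => if (j : ℕ) < m then Qnew j else Qold j

/-- `Q 0, Q 1, Q 2, …` are the successive sweeps of the iterative water-filling started at `Q₀`:
in sweep `k` the users are updated one after the other, and the new covariance of user `i`
maximizes the energy efficiency, given the already updated covariances of the users before `i`
and the old ones of the users after `i`. -/
def MIMOBC.IsIterativeWaterfilling {K N M : ℕ} (S : MIMOBC K N M) (T : Finset (Fin M))
    (Q₀ : CovTuple K N) (Q : ℕ → CovTuple K N) : Prop :=
  Q 0 = Q₀ ∧ ∀ (k : ℕ) (i : Fin K),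
    S.IsBlockMaximizer T i (midSweep (Q k) (Q (k + 1)) i) (Q (k + 1) i)

end

/-! The energy efficiency `ee` is a concave rate over a positive affine power, hence pseudo-concave.
Indeed `log det` lies below its tangents, and freezing the ratio at its value at P turns this into a
tangent inequality for `ee` (`totalPower_mul_ee_sub_le`). First-order conditions therefore suffice
for optimality. The rate grows more slowly than any linear function of the trace, so superlevel sets
at positive levels are bounded and maximizers exist.

The tangent inequality keeps a quadratic remainder in `linPart`. Complementary slackness forces a
maximizer for user i into the form H Y Hᴴ with H the channel of that user, and on such matrices the
map X ↦ HᴴXH is injective. The remainder then yields both uniqueness of block maximizers and an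
increase of `ee` that dominates the squared length of each update.

Global maximizers need not be unique, so convergence of the iterates, and not only of the values,
needs an argument of Łojasiewicz type. Let r be the optimality gap after a sweep and d the length of
that sweep. Comparing the blockwise first-order conditions gives r ≤ C d · ‖P - Z‖ for every
maximizer Z (`exists_gap_le`). Some maximizer lies within C r^γ (`exists_error_bound`): every
feasible point with the `linPart` and total trace of a maximizer is a maximizer, and such a linear
system over the semidefinite cone has a Hölder error bound, obtained by facial reduction
(`exists_holder_error_bound`). Together with sufficient increase this makes the sweep lengths
summable (`summable_of_sufficient_decrease`), so the iterates are Cauchy; d → 0 in the gap bound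
makes the limit optimal. -/

section MatrixFacts

/-! ### Semidefinite matrices and the tangent inequality for `log det`. -/

open scoped Matrix.Norms.L2Operator MatrixOrder
open Matrix

set_option linter.unusedSectionVars false

variable {n : Type*} [Fintype n] [DecidableEq n]

theorem Matrix.IsHermitian.posSemidef_smul_one_add {E : Matrix n n ℂ} (hE : E.IsHermitian) {r : ℝ}
    (hr : ‖E‖ ≤ r) : (r • (1 : Matrix n n ℂ) + E).PosSemidef := by
  have h : -(algebraMap ℝ (Matrix n n ℂ)) ‖E‖ ≤ E :=
    IsSelfAdjoint.neg_algebraMap_norm_le_self (a := E) hE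
  have h1 : ((r - ‖E‖) • (1 : Matrix n n ℂ)).PosSemidef :=
    PosSemidef.one.smul (sub_nonneg.2 hr)
  have h2 := (Matrix.le_iff.1 h).add h1
  have h3 : r • (1 : Matrix n n ℂ) + E =
      E - -(algebraMap ℝ (Matrix n n ℂ)) ‖E‖ + (r - ‖E‖) • 1 := by
    rw [Algebra.algebraMap_eq_smul_one, sub_smul]
    abel
  exact h3 ▸ h2

theorem Matrix.PosSemidef.exists_eq_conjTranspose_mul_self {A : Matrix n n ℂ}
    (hA : A.PosSemidef) : ∃ B : Matrix n n ℂ, A = Bᴴ * B :=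
  CStarAlgebra.nonneg_iff_eq_star_mul_self.1 (Matrix.nonneg_iff_posSemidef.2 hA)

theorem Matrix.PosSemidef.re_trace_nonneg {A : Matrix n n ℂ} (hA : A.PosSemidef) :
    0 ≤ A.trace.re :=
  (Complex.nonneg_iff.1 hA.trace_nonneg).1

theorem Matrix.PosSemidef.re_trace_eq_zero_iff {A : Matrix n n ℂ} (hA : A.PosSemidef) :
    A.trace.re = 0 ↔ A = 0 := by
  rw [← hA.trace_eq_zero_iff, Complex.ext_iff]
  simp [(Complex.nonneg_iff.1 hA.trace_nonneg).2.symm]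

theorem Matrix.PosSemidef.re_trace_mul_nonneg {A B : Matrix n n ℂ} (hA : A.PosSemidef)
    (hB : B.PosSemidef) : 0 ≤ (A * B).trace.re := by
  obtain ⟨C, rfl⟩ := hB.exists_eq_conjTranspose_mul_self
  rw [← Matrix.mul_assoc, Matrix.trace_mul_comm, ← Matrix.mul_assoc]
  exact (hA.mul_mul_conjTranspose_same C).re_trace_nonneg

/-- Complementary slackness: for A = DᴴD and B = CᴴC the trace is the squared Frobenius norm of D
Cᴴ. -/
theorem Matrix.PosSemidef.mul_eq_zero_of_re_trace {A B : Matrix n n ℂ} (hA : A.PosSemidef)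
    (hB : B.PosSemidef) (h : (A * B).trace.re = 0) : A * B = 0 := by
  obtain ⟨C, rfl⟩ := hB.exists_eq_conjTranspose_mul_self
  obtain ⟨D, rfl⟩ := hA.exists_eq_conjTranspose_mul_self
  have h1 : (Dᴴ * D * (Cᴴ * C)).trace = ((D * Cᴴ)ᴴ * (D * Cᴴ)).trace := by
    rw [← Matrix.mul_assoc, Matrix.trace_mul_comm]
    simp [Matrix.mul_assoc]
  rw [h1] at h
  have h2 := (posSemidef_conjTranspose_mul_self (D * Cᴴ)).re_trace_eq_zero_iff.1 h
  have h3 : D * Cᴴ = 0 := Matrix.conjTranspose_mul_self_eq_zero.1 h2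
  rw [Matrix.mul_assoc, ← Matrix.mul_assoc D, h3]
  simp

/-- Self-duality of the semidefinite cone; the rank-one matrices x xᴴ suffice as tests. -/
theorem Matrix.posSemidef_of_re_trace_mul_nonneg {A : Matrix n n ℂ} (hA : A.IsHermitian)
    (h : ∀ B : Matrix n n ℂ, B.PosSemidef → 0 ≤ (A * B).trace.re) : A.PosSemidef := by
  refine PosSemidef.of_dotProduct_mulVec_nonneg hA fun x => ?_
  have h1 := h _ (posSemidef_vecMulVec_self_star x)
  rw [Matrix.mul_vecMulVec, Matrix.trace_vecMulVec, dotProduct_comm] at h1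
  rw [Complex.nonneg_iff]
  refine ⟨h1, ?_⟩
  have h2 := hA.im_star_dotProduct_mulVec_self x
  simpa using h2.symm

theorem Matrix.exists_abs_re_trace_le (n : Type*) [Fintype n] [DecidableEq n] :
    ∃ C : ℝ, 0 ≤ C ∧ ∀ A : Matrix n n ℂ, |A.trace.re| ≤ C * ‖A‖ := by
  let f : Matrix n n ℂ →ₗ[ℝ] ℝ :=
    Complex.reLm.comp ((Matrix.traceLinearMap n ℂ ℂ).restrictScalars ℝ)
  refine ⟨‖LinearMap.toContinuousLinearMap f‖, norm_nonneg _, fun A => ?_⟩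
  exact (LinearMap.toContinuousLinearMap f).le_opNorm A

theorem Matrix.IsHermitian.exists_norm_le_abs_eigenvalue [Nonempty n] {A : Matrix n n ℂ}
    (hA : A.IsHermitian) : ∃ i, ‖A‖ ≤ |hA.eigenvalues i| := by
  obtain ⟨i, hi⟩ := Finite.exists_max fun i => |hA.eigenvalues i|
  refine ⟨i, ?_⟩
  have h := hA.spectral_theorem
  rw [Unitary.conjStarAlgAut_apply] at h
  have h1 : ‖A‖ = ‖(diagonal (RCLike.ofReal ∘ hA.eigenvalues) : Matrix n n ℂ)‖ := by
    conv_lhs => rw [h]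
    rw [← Unitary.coe_star, CStarRing.norm_mul_coe_unitary, CStarRing.norm_coe_unitary_mul]
  rw [h1, Matrix.l2_opNorm_diagonal]
  refine (pi_norm_le_iff_of_nonneg (abs_nonneg _)).2 fun j => ?_
  simpa using hi j

theorem Matrix.IsHermitian.abs_eigenvalue_le_norm {A : Matrix n n ℂ}
    (hA : A.IsHermitian) (i : n) : |hA.eigenvalues i| ≤ ‖A‖ := by
  have h := hA.spectral_theorem
  rw [Unitary.conjStarAlgAut_apply] at h
  have h1 : ‖A‖ = ‖(diagonal (RCLike.ofReal ∘ hA.eigenvalues) : Matrix n n ℂ)‖ := by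
    conv_lhs => rw [h]
    rw [← Unitary.coe_star, CStarRing.norm_mul_coe_unitary, CStarRing.norm_coe_unitary_mul]
  rw [h1, Matrix.l2_opNorm_diagonal]
  simpa using norm_le_pi_norm (RCLike.ofReal ∘ hA.eigenvalues : n → ℂ) i

theorem Matrix.PosSemidef.norm_le_re_trace {A : Matrix n n ℂ} (hA : A.PosSemidef) :
    ‖A‖ ≤ A.trace.re := by
  cases isEmpty_or_nonempty n
  · have : A = 0 := Subsingleton.elim _ _
    simp [this]
  obtain ⟨i, hi⟩ := hA.1.exists_norm_le_abs_eigenvalue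
  rw [abs_of_nonneg (hA.eigenvalues_nonneg i)] at hi
  rw [hA.1.trace_eq_sum_eigenvalues, Complex.re_sum]
  exact hi.trans (Finset.single_le_sum (f := fun i => ((hA.1.eigenvalues i : ℂ)).re)
    (fun j _ => by simpa using hA.eigenvalues_nonneg j) (Finset.mem_univ i))

theorem Matrix.PosDef.exists_pos_sub_smul_one {A : Matrix n n ℂ} (hA : A.PosDef) :
    ∃ c : ℝ, 0 < c ∧ (A - c • (1 : Matrix n n ℂ)).PosSemidef := by
  cases isEmpty_or_nonempty n
  · refine ⟨1, one_pos, ?_⟩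
    rw [Subsingleton.elim (A - _) 0]
    exact PosSemidef.zero
  have h := (CFC.exists_pos_algebraMap_le_iff (A := Matrix n n ℂ) (a := A) hA.1).2 fun x hx =>
    (Matrix.isStrictlyPositive_iff_posDef.2 hA).spectrum_pos hx
  obtain ⟨r, hr, h⟩ := h
  refine ⟨r, hr, ?_⟩
  rw [← Algebra.algebraMap_eq_smul_one]
  exact Matrix.le_iff.1 h

theorem Matrix.PosDef.of_sub_one {A : Matrix n n ℂ} (hA : (A - 1).PosSemidef) : A.PosDef := by
  have := PosDef.one.add_posSemidef hA
  simpa using this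

/-- Conjugating A(A - 1) = (A - 1) + (A - 1)² ≥ 0 by A⁻¹ gives 1 - A⁻¹ ≥ 0. This keeps the gradient
bounds uniform over the feasible set. -/
theorem Matrix.inv_norm_le_one {A : Matrix n n ℂ} (hA : (A - 1).PosSemidef) : ‖A⁻¹‖ ≤ 1 := by
  have hP := PosDef.of_sub_one hA
  have hu : IsUnit A.det := (Matrix.isUnit_iff_isUnit_det _).1 hP.isUnit
  have h0 : (0 : Matrix n n ℂ) ≤ A⁻¹ := Matrix.nonneg_iff_posSemidef.2 hP.inv.posSemidef
  refine (CStarAlgebra.norm_le_one_iff_of_nonneg A⁻¹ h0).2 (Matrix.le_iff.2 ?_)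
  have h1 : ((A - 1) + (A - 1)ᴴ * (A - 1)).PosSemidef :=
    hA.add (posSemidef_conjTranspose_mul_self _)
  have h2 := h1.conjTranspose_mul_mul_same A⁻¹
  rw [hP.inv.1.eq, hA.1.eq] at h2
  have h3 : A - 1 + (A - 1) * (A - 1) = A * (A - 1) := by noncomm_ring
  rwa [h3, ← Matrix.mul_assoc, Matrix.nonsing_inv_mul _ hu, Matrix.one_mul, Matrix.sub_mul,
    Matrix.mul_nonsing_inv _ hu, Matrix.one_mul] at h2

/-- For x = y², log x = 2 log y ≤ 2(y - 1) = (x - 1) - (y - 1)², and (y + 1)² ≤ 2(y² + 1) bounds the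
last square from below. -/
theorem Real.log_le_sub_one_sub_sq {x : ℝ} (hx : 0 < x) :
    Real.log x ≤ x - 1 - (x - 1) ^ 2 / (2 * (x + 1)) := by
  obtain ⟨y, hy, rfl⟩ : ∃ y : ℝ, 0 < y ∧ x = y ^ 2 :=
    ⟨√x, Real.sqrt_pos.2 hx, (Real.sq_sqrt hx.le).symm⟩
  have h1 := Real.log_le_sub_one_of_pos hy
  have h2 : (y ^ 2 - 1) ^ 2 / (2 * (y ^ 2 + 1)) ≤ (y - 1) ^ 2 := by
    rw [div_le_iff₀ (by positivity)]
    nlinarith [mul_nonneg (sq_nonneg (y - 1)) (sq_nonneg (y - 1))]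
  rw [Real.log_pow]
  push_cast
  nlinarith

/-- The scalar inequality is summed over the eigenvalues; only the remainder of the eigenvalue
farthest from 1, which realises ‖A - 1‖, is kept. -/
theorem Matrix.PosDef.log_det_le {A : Matrix n n ℂ} (hA : A.PosDef) :
    Real.log A.det.re ≤ (A - 1).trace.re - ‖A - 1‖ ^ 2 / (2 * (‖A‖ + 1)) := by
  cases isEmpty_or_nonempty n
  · simp [Subsingleton.elim (A - 1) 0, Matrix.det_isEmpty]
  have hpos := hA.eigenvalues_pos
  have hdet : A.det.re = ∏ i, hA.1.eigenvalues i := by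
    rw [hA.1.det_eq_prod_eigenvalues]
    norm_cast
  have htr : (A - 1).trace.re = ∑ i, (hA.1.eigenvalues i - 1) := by
    rw [Matrix.trace_sub, hA.1.trace_eq_sum_eigenvalues]
    simp
  obtain ⟨j, hj⟩ : ∃ j, ‖A - 1‖ ≤ |hA.1.eigenvalues j - 1| := by
    obtain ⟨i, hi⟩ := Finite.exists_max fun i => |hA.1.eigenvalues i - 1|
    refine ⟨i, ?_⟩
    have h := hA.1.spectral_theorem
    rw [Unitary.conjStarAlgAut_apply] at h
    have h1 : A - 1 = (hA.1.eigenvectorUnitary : Matrix n n ℂ) *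
        diagonal (fun i => (hA.1.eigenvalues i : ℂ) - 1) *
        ((star hA.1.eigenvectorUnitary : unitary (Matrix n n ℂ)) : Matrix n n ℂ) := by
      conv_lhs => rw [h]
      have : (diagonal (fun i => (hA.1.eigenvalues i : ℂ) - 1) : Matrix n n ℂ) =
          diagonal (RCLike.ofReal ∘ hA.1.eigenvalues) - 1 := by
        rw [← diagonal_one, diagonal_sub]
        rfl
      rw [this, Matrix.mul_sub, Matrix.sub_mul, Matrix.mul_one]
      congr 1
      exact (Unitary.coe_mul_star_self _).symm
    rw [h1, CStarRing.norm_mul_coe_unitary, CStarRing.norm_coe_unitary_mul,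
      Matrix.l2_opNorm_diagonal]
    refine (pi_norm_le_iff_of_nonneg (abs_nonneg _)).2 fun k => ?_
    have := hi k
    rwa [← Complex.ofReal_one, ← Complex.ofReal_sub, Complex.norm_real]
  rw [hdet, htr, Real.log_prod fun i _ => (hpos i).ne']
  have key : ∑ i, Real.log (hA.1.eigenvalues i) ≤ ∑ i, ((hA.1.eigenvalues i - 1) -
      (hA.1.eigenvalues i - 1) ^ 2 / (2 * (hA.1.eigenvalues i + 1))) :=
    Finset.sum_le_sum fun i _ => Real.log_le_sub_one_sub_sq (hpos i)
  rw [Finset.sum_sub_distrib] at key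
  have h1 : (hA.1.eigenvalues j - 1) ^ 2 / (2 * (hA.1.eigenvalues j + 1)) ≤
      ∑ i, (hA.1.eigenvalues i - 1) ^ 2 / (2 * (hA.1.eigenvalues i + 1)) :=
    Finset.single_le_sum (f := fun i => (hA.1.eigenvalues i - 1) ^ 2 /
      (2 * (hA.1.eigenvalues i + 1))) (fun i _ => by have := hpos i; positivity)
      (Finset.mem_univ j)
  have h2 : ‖A - 1‖ ^ 2 / (2 * (‖A‖ + 1)) ≤
      (hA.1.eigenvalues j - 1) ^ 2 / (2 * (hA.1.eigenvalues j + 1)) := by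
    have h3 := hpos j
    have h4 := (le_abs_self _).trans (hA.1.abs_eigenvalue_le_norm j)
    rw [← sq_abs (hA.1.eigenvalues j - 1)]
    gcongr
  linarith

/-- The tangent inequality for the concave function `log det`, with a quadratic remainder. -/
theorem Matrix.log_det_le_add_trace {A B : Matrix n n ℂ} (hA : (A - 1).PosSemidef)
    (hB : B.PosDef) :
    Real.log B.det.re ≤ Real.log A.det.re + (A⁻¹ * (B - A)).trace.re -
      ‖B - A‖ ^ 2 / (2 * ‖A‖ ^ 2 * (‖B‖ + 1)) := by
  have hP := PosDef.of_sub_one hA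
  obtain ⟨C, hC⟩ := hP.posSemidef.exists_eq_conjTranspose_mul_self
  have hu : IsUnit C.det := by
    have h := (Matrix.isUnit_iff_isUnit_det _).1 hP.isUnit
    rw [hC, Matrix.det_mul] at h
    exact isUnit_of_mul_isUnit_right h
  have huH : IsUnit Cᴴ.det := by
    rw [Matrix.det_conjTranspose]
    exact hu.star
  have hAinv : A⁻¹ = C⁻¹ * Cᴴ⁻¹ := by rw [hC, Matrix.mul_inv_rev]
  -- Congruence by C⁻¹ carries A to 1 and B to T. Since A ≥ 1, C⁻¹ is a contraction, so ‖T‖ ≤ ‖B‖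
  -- and no norm of A⁻¹ enters the remainder.
  set T := (C⁻¹)ᴴ * B * C⁻¹ with hT
  have hTP : T.PosDef := hB.conjTranspose_mul_mul_same
    (Matrix.mulVec_injective_of_isUnit ((Matrix.isUnit_iff_isUnit_det _).2
      (Matrix.isUnit_nonsing_inv_det C hu)))
  have hBT : B = Cᴴ * T * C := by
    rw [hT, Matrix.conjTranspose_nonsing_inv]
    simp only [Matrix.mul_assoc]
    rw [Matrix.nonsing_inv_mul _ hu, Matrix.mul_one, Matrix.mul_nonsing_inv_cancel_left _ _ huH]
  have hBA : B - A = Cᴴ * (T - 1) * C := by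
    rw [Matrix.mul_sub, Matrix.sub_mul, ← hBT, Matrix.mul_one, ← hC]
  have hnC : ‖C‖ * ‖C‖ = ‖A‖ := by rw [hC, Matrix.l2_opNorm_conjTranspose_mul_self]
  have hnCi : ‖C⁻¹‖ * ‖C⁻¹‖ ≤ 1 := by
    have h1 := Matrix.l2_opNorm_conjTranspose_mul_self (C⁻¹)ᴴ
    rw [Matrix.conjTranspose_conjTranspose, Matrix.conjTranspose_nonsing_inv, ← hAinv,
      ← Matrix.conjTranspose_nonsing_inv, Matrix.l2_opNorm_conjTranspose] at h1
    rw [← h1]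
    exact Matrix.inv_norm_le_one hA
  have htr : (A⁻¹ * (B - A)).trace = (T - 1).trace := by
    rw [hAinv, hBA, Matrix.mul_assoc, Matrix.mul_assoc Cᴴ,
      Matrix.nonsing_inv_mul_cancel_left _ _ huH, Matrix.trace_mul_comm, Matrix.mul_assoc,
      Matrix.mul_nonsing_inv _ hu, Matrix.mul_one]
  have hdet : B.det.re = A.det.re * T.det.re := by
    have h1 : B.det = A.det * T.det := by
      rw [hBT, hC]
      simp only [Matrix.det_mul]
      ring
    have h2 := (Complex.pos_iff.1 hTP.det_pos).2
    rw [h1, Complex.mul_re, ← h2]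
    ring
  have h1 := hTP.log_det_le
  have hAd := (Complex.pos_iff.1 hP.det_pos).1
  have hTd := (Complex.pos_iff.1 hTP.det_pos).1
  rw [hdet, Real.log_mul hAd.ne' hTd.ne', htr]
  have h2 : ‖B - A‖ ^ 2 / (2 * ‖A‖ ^ 2 * (‖B‖ + 1)) ≤ ‖T - 1‖ ^ 2 / (2 * (‖T‖ + 1)) := by
    have h3 : ‖B - A‖ ≤ ‖A‖ * ‖T - 1‖ := by
      rw [hBA, ← hnC]
      calc _ ≤ ‖Cᴴ‖ * ‖T - 1‖ * ‖C‖ :=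
            (norm_mul_le _ _).trans (by gcongr; exact norm_mul_le _ _)
        _ = _ := by rw [Matrix.l2_opNorm_conjTranspose]; ring
    have h4 : ‖T‖ ≤ ‖B‖ := by
      calc ‖T‖ ≤ ‖(C⁻¹)ᴴ‖ * ‖B‖ * ‖C⁻¹‖ :=
            (norm_mul_le _ _).trans (by gcongr; exact norm_mul_le _ _)
        _ = (‖C⁻¹‖ * ‖C⁻¹‖) * ‖B‖ := by rw [Matrix.l2_opNorm_conjTranspose]; ring
        _ ≤ 1 * ‖B‖ := by gcongr
        _ = ‖B‖ := one_mul _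
    -- As A ≥ 1, the norm vanishes only for 0 × 0 matrices; the left quotient is then 0 by the
    -- convention for division by zero.
    rcases eq_or_ne ‖A‖ 0 with h0 | h0
    · rw [h0]
      simp only [ne_eq, OfNat.ofNat_ne_zero, not_false_eq_true, zero_pow, mul_zero, zero_mul,
        div_zero]
      positivity
    have hx := norm_nonneg (B - A)
    have hb := norm_nonneg B
    have ht := norm_nonneg T
    generalize ‖B - A‖ = x, ‖T - 1‖ = y, ‖B‖ = b, ‖T‖ = t, ‖A‖ = a at *
    calc x ^ 2 / (2 * a ^ 2 * (b + 1))
        ≤ (a * y) ^ 2 / (2 * a ^ 2 * (b + 1)) := by gcongr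
      _ = y ^ 2 / (2 * (b + 1)) := by field_simp
      _ ≤ _ := by gcongr
  linarith

theorem Matrix.norm_inv_sub_inv_le {A B : Matrix n n ℂ} (hA : (A - 1).PosSemidef)
    (hB : (B - 1).PosSemidef) : ‖A⁻¹ - B⁻¹‖ ≤ ‖A - B‖ := by
  have huA := (Matrix.isUnit_iff_isUnit_det _).1 (PosDef.of_sub_one hA).isUnit
  have huB := (Matrix.isUnit_iff_isUnit_det _).1 (PosDef.of_sub_one hB).isUnit
  have h : A⁻¹ - B⁻¹ = A⁻¹ * (B - A) * B⁻¹ := by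
    rw [Matrix.mul_sub, Matrix.sub_mul, Matrix.mul_assoc, Matrix.mul_nonsing_inv _ huB,
      Matrix.nonsing_inv_mul _ huA]
    simp
  rw [h]
  calc _ ≤ ‖A⁻¹‖ * ‖B - A‖ * ‖B⁻¹‖ := (norm_mul_le _ _).trans (by gcongr; exact norm_mul_le _ _)
    _ ≤ 1 * ‖B - A‖ * 1 := by
      gcongr
      exacts [Matrix.inv_norm_le_one hA, Matrix.inv_norm_le_one hB]
    _ = ‖A - B‖ := by rw [one_mul, mul_one, norm_sub_rev]

end MatrixFacts

/-! ### Hölder error bounds for linear equations over the semidefinite cone. -/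

section ErrorBound

open scoped Matrix.Norms.L2Operator MatrixOrder
open Matrix

universe u

set_option linter.unusedSectionVars false

variable {n : Type u} [Fintype n] [DecidableEq n] {E : Type*} [NormedAddCommGroup E]
  [NormedSpace ℝ E]

/-- The Hermitian part of a matrix, as a real linear map. -/
noncomputable def Matrix.hermPart (n : Type*) : Matrix n n ℂ →ₗ[ℝ] Matrix n n ℂ where
  toFun X := (1 / 2 : ℝ) • (X + Xᴴ)
  map_add' X Y := by rw [conjTranspose_add, ← smul_add]; congr 1; abel
  map_smul' c X := by
    rw [conjTranspose_smul, star_trivial, ← smul_add, smul_comm]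
    rfl

theorem Matrix.hermPart_apply (X : Matrix n n ℂ) : hermPart n X = (1 / 2 : ℝ) • (X + Xᴴ) := rfl

theorem Matrix.hermPart_isHermitian (X : Matrix n n ℂ) : (hermPart n X).IsHermitian := by
  rw [Matrix.IsHermitian, hermPart_apply, conjTranspose_smul, conjTranspose_add,
    conjTranspose_conjTranspose, star_trivial, add_comm]

theorem Matrix.IsHermitian.hermPart_eq {X : Matrix n n ℂ} (hX : X.IsHermitian) :
    hermPart n X = X := by
  rw [hermPart_apply, hX.eq, ← two_smul ℝ X, smul_smul]
  norm_num

theorem Matrix.norm_hermPart_le (X : Matrix n n ℂ) : ‖hermPart n X‖ ≤ ‖X‖ := by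
  rw [hermPart_apply, norm_smul]
  have h := norm_add_le X Xᴴ
  rw [l2_opNorm_conjTranspose] at h
  norm_num
  linarith

/-- Positive definite matrices are open only among Hermitian ones; pulling back along `hermPart`
gives an open set of all matrices, as the open mapping theorem needs. -/
theorem Matrix.isOpen_hermPart_posDef : IsOpen {X : Matrix n n ℂ | (hermPart n X).PosDef} := by
  rw [Metric.isOpen_iff]
  intro X hX
  obtain ⟨c, hc, hXc⟩ := hX.exists_pos_sub_smul_one
  refine ⟨c, hc, fun Z hZ => ?_⟩
  rw [mem_ball_iff_norm] at hZ
  set D := hermPart n (Z - X) with hD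
  have hDn : ‖D‖ < c := (norm_hermPart_le _).trans_lt hZ
  have h1 := (hermPart_isHermitian (Z - X)).posSemidef_smul_one_add (le_refl ‖D‖)
  have h2 : ((c - ‖D‖) • (1 : Matrix n n ℂ)).PosDef := PosDef.one.smul (sub_pos.2 hDn)
  have h3 : hermPart n Z = (c - ‖D‖) • (1 : Matrix n n ℂ) + ((hermPart n X - c • 1) +
      (‖D‖ • 1 + D)) := by
    rw [hD, map_sub, sub_smul]
    abel
  change (hermPart n Z).PosDef
  rw [h3]
  exact h2.add_posSemidef (hXc.add h1)

/-- Riesz representation for the pairing Re tr(YX); replacing Y by its Hermitian part changes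
nothing on Hermitian X. -/
theorem Matrix.exists_re_trace_mul_eq (ψ : Matrix n n ℂ →ₗ[ℝ] ℝ) :
    ∃ Y : Matrix n n ℂ, Y.IsHermitian ∧
      ∀ X : Matrix n n ℂ, X.IsHermitian → (Y * X).trace.re = ψ X := by
  have key : ∃ Y : Matrix n n ℂ, ∀ X : Matrix n n ℂ, (Y * X).trace.re = ψ X := by
    refine ⟨Matrix.of fun j i => (ψ (single i j 1) : ℂ) - Complex.I * (ψ (single i j Complex.I) : ℂ),
      fun X => ?_⟩
    have hX : X = ∑ i, ∑ j, ((X i j).re • single i j (1 : ℂ) +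
        (X i j).im • single i j Complex.I) := by
      conv_lhs => rw [matrix_eq_sum_single X]
      refine Finset.sum_congr rfl fun i _ => Finset.sum_congr rfl fun j _ => ?_
      rw [smul_single, smul_single, ← single_add]
      congr 1
      apply Complex.ext <;> simp
    conv_rhs => rw [hX]
    simp only [map_sum, map_add, map_smul, smul_eq_mul, Matrix.trace, Matrix.diag_apply,
      Matrix.mul_apply, Matrix.of_apply, Complex.re_sum]
    rw [Finset.sum_comm]
    refine Finset.sum_congr rfl fun i _ => Finset.sum_congr rfl fun j _ => ?_
    simp
    ring
  obtain ⟨Y, hY⟩ := key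
  refine ⟨hermPart n Y, hermPart_isHermitian _, fun X hX => ?_⟩
  have h1 : (Yᴴ * X).trace.re = (Y * X).trace.re := by
    have h2 : (Yᴴ * X).trace = star (Y * X).trace := by
      rw [← trace_conjTranspose, conjTranspose_mul, hX.eq, trace_mul_comm]
    rw [h2]
    simp
  rw [hermPart_apply, smul_mul_assoc, Matrix.add_mul, trace_smul, trace_add, Complex.real_smul,
    Complex.re_ofReal_mul, Complex.add_re, h1, hY]
  ring

/-- If no positive definite matrix satisfies the linear system `L X = L X₀`, then some nonzero
positive semidefinite matrix is orthogonal to all positive semidefinite solutions, with a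
quantitative estimate for approximate solutions. -/
theorem Matrix.exists_posSemidef_separating (L : Matrix n n ℂ →ₗ[ℝ] E) {X₀ : Matrix n n ℂ}
    (hX₀ : X₀.PosSemidef) (hno : ∀ X : Matrix n n ℂ, X.PosDef → L X ≠ L X₀) :
    ∃ Y : Matrix n n ℂ, Y.PosSemidef ∧ Y ≠ 0 ∧ ∃ C : ℝ, 0 ≤ C ∧
      ∀ X : Matrix n n ℂ, X.IsHermitian → (Y * X).trace.re ≤ C * ‖L X - L X₀‖ := by
  set B := L ∘ₗ hermPart n with hB
  have hBH : ∀ X : Matrix n n ℂ, X.IsHermitian → B X = L X := fun X hX => by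
    rw [hB, LinearMap.comp_apply, hX.hermPart_eq]
  set U := {X : Matrix n n ℂ | (hermPart n X).PosDef}
  -- The image of the positive definite cone is open and convex in the range of `B` and misses the
  -- image of X₀, so Hahn-Banach separates them strictly.
  have hopen : IsOpen (B.rangeRestrict '' U) :=
    B.rangeRestrict.isOpenMap_of_finiteDimensional B.surjective_rangeRestrict U
      isOpen_hermPart_posDef
  have hconv : Convex ℝ (B.rangeRestrict '' U) := by
    refine Convex.linear_image ?_ _
    intro X hX Z hZ a b ha hb hab
    change (hermPart n (a • X + b • Z)).PosDef
    rw [map_add, map_smul, map_smul]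
    rcases ha.eq_or_lt with rfl | ha
    · have : b = 1 := by linarith
      subst this
      simpa using (show (hermPart n Z).PosDef from hZ)
    · exact (PosDef.smul hX ha).add_posSemidef (hZ.posSemidef.smul hb)
  have hnot : B.rangeRestrict X₀ ∉ B.rangeRestrict '' U := by
    rintro ⟨X, hX, hXe⟩
    have h1 : B X = B X₀ := congrArg Subtype.val hXe
    rw [hBH X₀ hX₀.1] at h1
    exact hno _ hX h1
  obtain ⟨f, hf⟩ := geometric_hahn_banach_point_open hconv hopen hnot
  set ψ : Matrix n n ℂ →ₗ[ℝ] ℝ := f.toLinearMap ∘ₗ B.rangeRestrict with hψ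
  have hψlt : ∀ X : Matrix n n ℂ, X.PosDef → ψ X₀ < ψ X := fun X hX =>
    hf _ ⟨X, by change (hermPart n X).PosDef; rwa [hX.1.hermPart_eq], rfl⟩
  -- By homogeneity of the cone, large s forces ψ ≥ 0 on it and small s forces ψ X₀ ≤ 0, so the
  -- separating value is 0.
  have hscale : ∀ X : Matrix n n ℂ, X.PosDef → ∀ s : ℝ, 0 < s → ψ X₀ < s * ψ X :=
    fun X hX s hs => by
      have := hψlt _ (hX.smul hs)
      rwa [map_smul, smul_eq_mul] at this
  have hPDnonneg : ∀ X : Matrix n n ℂ, X.PosDef → 0 ≤ ψ X := fun X hX => by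
    by_contra! hneg
    have h1 := hscale X hX (1 + |ψ X₀| / (-ψ X)) (by have := neg_pos.2 hneg; positivity)
    have h2 : (1 + |ψ X₀| / (-ψ X)) * ψ X = ψ X - |ψ X₀| := by
      rw [div_neg, add_mul, neg_mul, div_mul_cancel₀ _ hneg.ne]
      ring
    rw [h2] at h1
    linarith [neg_abs_le (ψ X₀)]
  have hPSD : ∀ X : Matrix n n ℂ, X.PosSemidef → 0 ≤ ψ X := fun X hX => by
    refine le_of_forall_pos_le_add fun ε hε => ?_
    have h1 := hPDnonneg _ ((PosDef.one.smul (α := ℝ)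
      (show 0 < ε / (1 + |ψ 1|) by positivity)).add_posSemidef hX)
    rw [map_add, map_smul, smul_eq_mul] at h1
    have h2 : ε / (1 + |ψ 1|) * ψ 1 ≤ ε := by
      rw [div_mul_eq_mul_div, div_le_iff₀ (by positivity)]
      nlinarith [le_abs_self (ψ 1)]
    linarith
  have hX₀le : ψ X₀ ≤ 0 := by
    by_contra! hpos
    have h1 := hscale 1 PosDef.one (ψ X₀ / (1 + |ψ 1|)) (by positivity)
    have h2 : ψ X₀ / (1 + |ψ 1|) * ψ 1 ≤ ψ X₀ := by
      rw [div_mul_eq_mul_div, div_le_iff₀ (by positivity)]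
      nlinarith [le_abs_self (ψ 1)]
    linarith
  have hX₀0 : ψ X₀ = 0 := le_antisymm hX₀le (hPSD _ hX₀)
  obtain ⟨Y, hYH, hY⟩ := exists_re_trace_mul_eq ψ
  refine ⟨Y, posSemidef_of_re_trace_mul_nonneg hYH fun X hX => ?_, ?_, ‖f‖, f.opNorm_nonneg,
    fun X hX => ?_⟩
  · rw [hY X hX.1]
    exact hPSD X hX
  · rintro rfl
    have h1 := hY 1 isHermitian_one
    have h2 := hψlt 1 PosDef.one
    rw [← h1, hX₀0] at h2
    simp at h2
  · rw [hY X hX]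
    have h1 : ψ X = f (B.rangeRestrict X - B.rangeRestrict X₀) := by
      rw [map_sub]
      change ψ X = ψ X - ψ X₀
      rw [hX₀0, sub_zero]
    rw [h1]
    refine (le_abs_self _).trans ((f.le_opNorm _).trans_eq ?_)
    rw [← hBH X hX, ← hBH X₀ hX₀.1]
    rfl

/-- Linear error bound for a linear matrix equation under Slater's condition. -/
theorem Matrix.error_bound_of_posDef (L : Matrix n n ℂ →ₗ[ℝ] E) {X₀ X₁ : Matrix n n ℂ}
    (hX₁ : X₁.PosDef) (h01 : L X₁ = L X₀) (R : ℝ) :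
    ∃ C : ℝ, 0 ≤ C ∧ ∀ X : Matrix n n ℂ, X.PosSemidef → ‖X‖ ≤ R →
      ∃ X' : Matrix n n ℂ, X'.PosSemidef ∧ L X' = L X₀ ∧ ‖X - X'‖ ≤ C * ‖L X - L X₀‖ := by
  set B := L ∘ₗ hermPart n with hB
  have hBH : ∀ X : Matrix n n ℂ, X.IsHermitian → B X = L X := fun X hX => by
    rw [hB, LinearMap.comp_apply, hX.hermPart_eq]
  obtain ⟨g, hg⟩ := B.rangeRestrict.exists_rightInverse_of_surjective
    (LinearMap.range_eq_top.2 B.surjective_rangeRestrict)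
  set gc := LinearMap.toContinuousLinearMap g
  obtain ⟨c, hc, hX₁c⟩ := hX₁.exists_pos_sub_smul_one
  refine ⟨‖gc‖ * (1 + (‖X₁‖ + |R|) / c), by positivity, fun X hX hXR => ?_⟩
  -- A bounded right inverse gives a Hermitian correction D with L D = L X₀ - L X, of the order of
  -- the residual. X + D solves the equation but may leave the cone.
  set D := hermPart n (g (B.rangeRestrict (X₁ - X))) with hD
  have hLD : L D = L X₀ - L X := by
    have h1 : L D = ((B.rangeRestrict (g (B.rangeRestrict (X₁ - X))) : B.range) : E) := rfl
    have h2 : B.rangeRestrict (g (B.rangeRestrict (X₁ - X))) = B.rangeRestrict (X₁ - X) :=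
      LinearMap.congr_fun hg _
    rw [h1, h2]
    change B (X₁ - X) = _
    rw [map_sub, hBH _ hX₁.1, hBH _ hX.1, h01]
  have hDn : ‖D‖ ≤ ‖gc‖ * ‖L X - L X₀‖ := by
    refine (norm_hermPart_le _).trans ((gc.le_opNorm _).trans_eq ?_)
    congr 1
    change ‖B (X₁ - X)‖ = _
    rw [map_sub, hBH _ hX₁.1, hBH _ hX.1, h01, norm_sub_rev]
  have hDP := (hermPart_isHermitian (g (B.rangeRestrict (X₁ - X)))).posSemidef_smul_one_add
    (le_refl ‖D‖)
  set e := ‖D‖ with he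
  have he0 : 0 ≤ e := norm_nonneg _
  have hec : 0 < e + c := by positivity
  -- Since X + D ≥ -e and X₁ ≥ c, the weight with t c = (1 - t) e pulls the convex combination back
  -- into the cone.
  set t := e / (e + c) with ht
  have ht0 : 0 ≤ t := by positivity
  have ht1 : t ≤ 1 := by rw [ht, div_le_one hec]; linarith
  have htc : t * c = (1 - t) * e := by rw [ht]; field_simp; ring
  have hte : t ≤ e / c := by rw [ht]; gcongr; linarith
  refine ⟨(1 - t) • (X + D) + t • X₁, ?_, ?_, ?_⟩
  · have h1 : (1 - t) • (X + D) + t • X₁ =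
        (1 - t) • X + (1 - t) • (e • 1 + D) + t • (X₁ - c • 1) := by
      simp only [smul_add, smul_sub, smul_smul, htc]
      abel
    rw [h1]
    exact ((hX.smul (sub_nonneg.2 ht1)).add (hDP.smul (sub_nonneg.2 ht1))).add (hX₁c.smul ht0)
  · rw [map_add, map_smul, map_smul, map_add, hLD, h01, add_sub_cancel, ← add_smul]
    simp
  · have h1 : X - ((1 - t) • (X + D) + t • X₁) = -((1 - t) • D + t • (X₁ - X)) := by
      simp only [smul_add, smul_sub, sub_smul, one_smul]
      abel
    rw [h1, norm_neg]
    calc ‖(1 - t) • D + t • (X₁ - X)‖ ≤ (1 - t) * e + t * ‖X₁ - X‖ := by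
          refine (norm_add_le _ _).trans_eq ?_
          rw [norm_smul, norm_smul, Real.norm_of_nonneg (sub_nonneg.2 ht1),
            Real.norm_of_nonneg ht0]
      _ ≤ 1 * e + (e / c) * (‖X₁‖ + |R|) := by
          gcongr
          · linarith
          · exact (norm_sub_le _ _).trans (by gcongr; exact hXR.trans (le_abs_self R))
      _ = e * (1 + (‖X₁‖ + |R|) / c) := by ring
      _ ≤ ‖gc‖ * ‖L X - L X₀‖ * (1 + (‖X₁‖ + |R|) / c) := by gcongr
      _ = _ := by ring

/-- A step of facial reduction: without Slater points, approximate solutions are close to their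
compression to a proper subspace. -/
theorem Matrix.exists_facial_reduction (L : Matrix n n ℂ →ₗ[ℝ] E) {X₀ : Matrix n n ℂ}
    (hX₀ : X₀.PosSemidef) (hno : ∀ X : Matrix n n ℂ, X.PosDef → L X ≠ L X₀) :
    ∃ (ι : Type u) (_ : Fintype ι) (V : Matrix n ι ℂ) (C : ℝ),
      Fintype.card ι < Fintype.card n ∧ 0 ≤ C ∧
      ∀ X : Matrix n n ℂ, X.PosSemidef →
        ‖X - V * Vᴴ * X * (V * Vᴴ)‖ ≤ C * √‖X‖ * √‖L X - L X₀‖ := by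
  classical
  obtain ⟨Y, hY, hY0, C, hC, hYC⟩ := exists_posSemidef_separating L hX₀ hno
  set d := hY.1.eigenvalues with hd
  have hdn : ∀ i, 0 ≤ d i := hY.eigenvalues_nonneg
  set U : Matrix n n ℂ := (hY.1.eigenvectorUnitary : Matrix n n ℂ) with hU
  have hUU : U * Uᴴ = 1 := Unitary.coe_mul_star_self hY.1.eigenvectorUnitary
  have hUU' : Uᴴ * U = 1 := Unitary.coe_star_mul_self hY.1.eigenvectorUnitary
  have hspec : Y = U * diagonal (fun i => (d i : ℂ)) * Uᴴ := by
    have h := hY.1.spectral_theorem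
    rw [Unitary.conjStarAlgAut_apply] at h
    exact h
  obtain ⟨δ, hδ, hδd⟩ : ∃ δ : ℝ, 0 < δ ∧ ∀ i, d i ≠ 0 → δ ≤ d i := by
    by_cases hne : (Finset.univ.filter fun i => d i ≠ 0).Nonempty
    · obtain ⟨i, hi, hmin⟩ := Finset.exists_min_image _ d hne
      simp only [Finset.mem_filter, Finset.mem_univ, true_and] at hi hmin
      exact ⟨d i, lt_of_le_of_ne (hdn i) (Ne.symm hi), hmin⟩
    · refine ⟨1, one_pos, fun i hi => absurd ⟨i, by simpa using hi⟩ hne⟩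
  -- N projects onto the range of Y, and Y ≥ δ N because every nonzero eigenvalue is at least δ.
  set N : Matrix n n ℂ := U * diagonal (fun i => if d i = 0 then (0 : ℂ) else 1) * Uᴴ with hN
  have hNH : Nᴴ = N := by
    rw [hN, conjTranspose_mul, conjTranspose_mul, conjTranspose_conjTranspose,
      diagonal_conjTranspose, Matrix.mul_assoc]
    congr 3
    ext i
    simp only [Pi.star_apply]
    split_ifs <;> simp
  have hNN : N * N = N := by
    rw [hN]
    have : U * diagonal (fun i => if d i = 0 then (0 : ℂ) else 1) * Uᴴ *
        (U * diagonal (fun i => if d i = 0 then (0 : ℂ) else 1) * Uᴴ) =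
        U * (diagonal (fun i => if d i = 0 then (0 : ℂ) else 1) * (Uᴴ * U) *
          diagonal (fun i => if d i = 0 then (0 : ℂ) else 1)) * Uᴴ := by
      simp only [Matrix.mul_assoc]
    rw [this, hUU', Matrix.mul_one, diagonal_mul_diagonal]
    congr 3
    ext i
    split_ifs <;> simp
  have hYN : (Y - δ • N).PosSemidef := by
    have h1 : Y - δ • N = U * diagonal (fun i => (d i : ℂ) -
        (δ : ℂ) * (if d i = 0 then (0 : ℂ) else 1)) * Uᴴ := by
      rw [hspec, hN, ← diagonal_sub, Matrix.mul_sub, Matrix.sub_mul]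
      congr 1
      rw [← Complex.coe_smul, ← Matrix.smul_mul, ← Matrix.mul_smul, ← diagonal_smul]
      rfl
    rw [h1]
    refine PosSemidef.mul_mul_conjTranspose_same (PosSemidef.diagonal fun i => ?_) U
    simp only [Pi.zero_apply]
    split_ifs with h
    · simp [h]
    · rw [mul_one, ← Complex.ofReal_sub]
      exact_mod_cast sub_nonneg.2 (hδd i h)
  -- The columns of V span the kernel of Y, a proper subspace because Y ≠ 0.
  set V : Matrix n {i // d i = 0} ℂ := U.submatrix id Subtype.val with hV
  have hVV : V * Vᴴ = 1 - N := by
    have h1 : 1 - N = U * diagonal (fun i => if d i = 0 then (1 : ℂ) else 0) * Uᴴ := by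
      have : (diagonal (fun i => if d i = 0 then (1 : ℂ) else 0) : Matrix n n ℂ) =
          1 - diagonal (fun i => if d i = 0 then (0 : ℂ) else 1) := by
        rw [← diagonal_one, diagonal_sub]
        congr 1
        ext i
        split_ifs <;> simp
      rw [this, Matrix.mul_sub, Matrix.sub_mul, Matrix.mul_one, hUU]
    rw [h1]
    ext a b
    rw [Matrix.mul_apply, Matrix.mul_apply]
    simp only [hV, Matrix.mul_diagonal, conjTranspose_apply, submatrix_apply, id]
    rw [← Finset.sum_subtype (Finset.univ.filter fun i => d i = 0) (by simp)
      (fun i => U a i * star (U b i)), Finset.sum_filter]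
    refine Finset.sum_congr rfl fun i _ => ?_
    split_ifs <;> simp
  refine ⟨{i // d i = 0}, inferInstance, V, 3 * √(C / δ), ?_, by positivity, fun X hX => ?_⟩
  · obtain ⟨i, hi⟩ : ∃ i, ¬ d i = 0 := by
      by_contra! h
      apply hY0
      rw [hspec]
      simp [h]
    exact Fintype.card_subtype_lt hi
  obtain ⟨B, hB⟩ := hX.exists_eq_conjTranspose_mul_self
  have hBn : ‖B‖ = √‖X‖ := by
    rw [hB, l2_opNorm_conjTranspose_mul_self, Real.sqrt_mul_self (norm_nonneg _)]
  -- ‖BN‖² = ‖NXN‖ ≤ tr(NX) ≤ tr(YX)/δ, and the separation estimate bounds tr(YX) by C times the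
  -- residual.
  have hBN : ‖B * N‖ ≤ √(C / δ) * √‖L X - L X₀‖ := by
    rw [← Real.sqrt_mul (by positivity)]
    refine Real.le_sqrt_of_sq_le ?_
    have h1 : ‖B * N‖ ^ 2 = ‖N * X * N‖ := by
      rw [sq, ← l2_opNorm_conjTranspose_mul_self, conjTranspose_mul, hNH, hB]
      simp only [Matrix.mul_assoc]
    have h2 : (N * X * N).PosSemidef := by
      have := hX.conjTranspose_mul_mul_same N
      rwa [hNH] at this
    have h3 : (N * X * N).trace = (N * X).trace := by
      rw [Matrix.mul_assoc, trace_mul_comm, Matrix.mul_assoc, hNN, trace_mul_comm]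
    have h4 := hYN.re_trace_mul_nonneg hX
    rw [Matrix.sub_mul, trace_sub, smul_mul_assoc, trace_smul, Complex.sub_re,
      Complex.real_smul, Complex.re_ofReal_mul] at h4
    rw [h1, div_mul_eq_mul_div, le_div_iff₀ hδ]
    have h5 := h2.norm_le_re_trace
    rw [h3] at h5
    have h6 := hYC X hX.1
    nlinarith
  have hN1 : ‖N‖ ≤ 1 := by
    have h := l2_opNorm_conjTranspose_mul_self N
    rw [hNH, hNN] at h
    nlinarith [norm_nonneg N]
  have hXN : ‖X * N‖ ≤ √‖X‖ * (√(C / δ) * √‖L X - L X₀‖) := by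
    calc ‖X * N‖ = ‖Bᴴ * (B * N)‖ := by rw [← Matrix.mul_assoc Bᴴ B N, ← hB]
      _ ≤ ‖Bᴴ‖ * ‖B * N‖ := norm_mul_le _ _
      _ ≤ _ := by
        rw [l2_opNorm_conjTranspose, hBn]
        gcongr
  have hNX : ‖N * X‖ = ‖X * N‖ := by
    rw [← l2_opNorm_conjTranspose, conjTranspose_mul, hNH, hX.1.eq]
  have h1 : X - V * Vᴴ * X * (V * Vᴴ) = N * X + X * N - N * (X * N) := by
    rw [hVV]
    noncomm_ring
  rw [h1]
  have h2 : ‖N * (X * N)‖ ≤ 1 * ‖X * N‖ := (norm_mul_le _ _).trans (by gcongr)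
  have h3 := norm_sub_le (N * X + X * N) (N * (X * N))
  have h4 := norm_add_le (N * X) (X * N)
  nlinarith

/-- **Hölder error bound** for linear matrix equations over the positive semidefinite cone. -/
theorem Matrix.exists_holder_error_bound (n : Type u) [Fintype n] [DecidableEq n]
    (L : Matrix n n ℂ →ₗ[ℝ] E) {X₀ : Matrix n n ℂ} (hX₀ : X₀.PosSemidef) (R : ℝ) :
    ∃ C γ : ℝ, 0 ≤ C ∧ 0 < γ ∧ γ ≤ 1 ∧ ∀ X : Matrix n n ℂ, X.PosSemidef → ‖X‖ ≤ R →
      ∃ X' : Matrix n n ℂ, X'.PosSemidef ∧ L X' = L X₀ ∧ ‖X - X'‖ ≤ C * ‖L X - L X₀‖ ^ γ := by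
  classical
  -- With a positive definite solution the bound is linear; otherwise facial reduction passes to
  -- smaller matrices and the exponent is halved.
  induction hk : Fintype.card n using Nat.strong_induction_on generalizing n R with
  | _ k ih =>
  by_cases hS : ∃ X₁ : Matrix n n ℂ, X₁.PosDef ∧ L X₁ = L X₀
  · obtain ⟨X₁, hX₁, h01⟩ := hS
    obtain ⟨C, hC, h⟩ := error_bound_of_posDef L hX₁ h01 R
    exact ⟨C, 1, hC, one_pos, le_rfl, by simpa using h⟩
  push Not at hS
  obtain ⟨ι, _, V, C₁, hι, hC₁, hV⟩ := exists_facial_reduction L hX₀ hS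
  let comp : Matrix ι ι ℂ →ₗ[ℝ] Matrix n n ℂ :=
    { toFun := fun Z => V * Z * Vᴴ
      map_add' := fun A B => by rw [Matrix.mul_add, Matrix.add_mul]
      map_smul' := fun c A => by
        rw [Matrix.mul_smul, Matrix.smul_mul]
        rfl }
  have hcomp : ∀ Z, comp Z = V * Z * Vᴴ := fun _ => rfl
  have hcompX : ∀ X : Matrix n n ℂ, comp (Vᴴ * X * V) = V * Vᴴ * X * (V * Vᴴ) := fun X => by
    rw [hcomp]
    simp only [Matrix.mul_assoc]
  -- X₀ has zero residual, so its compression is exact and the reduced system has the same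
  -- right-hand side.
  have hcX₀ : comp (Vᴴ * X₀ * V) = X₀ := by
    have h := hV X₀ hX₀
    rw [sub_self, norm_zero, Real.sqrt_zero, mul_zero] at h
    rw [hcompX]
    exact (sub_eq_zero.1 (norm_le_zero_iff.1 h)).symm
  obtain ⟨C, γ, hC, hγ, hγ1, hmain⟩ := ih _ (hk ▸ hι) ι (L ∘ₗ comp)
    (hX₀.conjTranspose_mul_mul_same V) (‖Vᴴ‖ * |R| * ‖V‖) rfl
  obtain ⟨l, hl, hL⟩ : ∃ l : ℝ, 0 ≤ l ∧ ∀ X, ‖L X‖ ≤ l * ‖X‖ := by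
    refine ⟨‖LinearMap.toContinuousLinearMap L‖, norm_nonneg _, fun X => ?_⟩
    exact (LinearMap.toContinuousLinearMap L).le_opNorm X
  set Δ := l * |R| + ‖L X₀‖ + 1 with hΔ
  have hΔ1 : 1 ≤ Δ := by rw [hΔ]; linarith [mul_nonneg hl (abs_nonneg R), norm_nonneg (L X₀)]
  set C₂ := l * (C₁ * √|R|) + √Δ with hC₂
  have hC₂0 : 0 ≤ C₂ := by positivity
  refine ⟨C₁ * √|R| * Δ + ‖V‖ * ‖Vᴴ‖ * (C * C₂ ^ γ), γ / 2, by positivity, by positivity,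
    by linarith, fun X hX hXR => ?_⟩
  have hXR' : ‖X‖ ≤ |R| := hXR.trans (le_abs_self R)
  set δ := ‖L X - L X₀‖ with hδ
  have hδ0 : 0 ≤ δ := norm_nonneg _
  have hδΔ : δ ≤ Δ := by
    refine (norm_sub_le _ _).trans ?_
    have := (hL X).trans (mul_le_mul_of_nonneg_left hXR' hl)
    rw [hΔ]
    linarith
  set Z := Vᴴ * X * V with hZ
  have hZn : ‖Z‖ ≤ ‖Vᴴ‖ * |R| * ‖V‖ := by
    refine (l2_opNorm_mul _ _).trans ?_
    gcongr
    refine (l2_opNorm_mul _ _).trans ?_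
    gcongr
  have hXZ : ‖X - comp Z‖ ≤ C₁ * √|R| * √δ := by
    rw [hcompX]
    refine (hV X hX).trans ?_
    gcongr
  have hLZ : ‖(L ∘ₗ comp) Z - (L ∘ₗ comp) (Vᴴ * X₀ * V)‖ ≤ C₂ * √δ := by
    rw [LinearMap.comp_apply, LinearMap.comp_apply, hcX₀]
    have h1 : L (comp Z) - L X₀ = (L X - L X₀) - L (X - comp Z) := by
      rw [map_sub]
      abel
    rw [h1]
    refine (norm_sub_le _ _).trans ?_
    have h2 := (hL (X - comp Z)).trans (mul_le_mul_of_nonneg_left hXZ hl)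
    have h3 : δ ≤ √Δ * √δ := by
      calc δ = √δ * √δ := (Real.mul_self_sqrt hδ0).symm
        _ ≤ √Δ * √δ := by gcongr
    rw [hC₂]
    linarith
  obtain ⟨Z', hZ', hLZ', hZZ'⟩ := hmain Z (hX.conjTranspose_mul_mul_same V) hZn
  refine ⟨comp Z', hZ'.mul_mul_conjTranspose_same V, ?_, ?_⟩
  · have h := hLZ'
    rwa [LinearMap.comp_apply, LinearMap.comp_apply, hcX₀] at h
  have hpow : (√δ) ^ γ = δ ^ (γ / 2) := by
    rw [Real.sqrt_eq_rpow, ← Real.rpow_mul hδ0]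
    congr 1
    ring
  -- The error of the compression has the better exponent 1/2; boundedness of δ weakens it to γ/2.
  have hsqrt : √δ ≤ Δ * δ ^ (γ / 2) := by
    have h1 : √δ = δ ^ ((1 - γ) / 2) * δ ^ (γ / 2) := by
      rw [Real.sqrt_eq_rpow, ← Real.rpow_add_of_nonneg hδ0 (by linarith) (by linarith)]
      congr 1
      ring
    rw [h1]
    gcongr
    calc δ ^ ((1 - γ) / 2) ≤ Δ ^ ((1 - γ) / 2) := by gcongr
      _ ≤ Δ ^ (1 : ℝ) := Real.rpow_le_rpow_of_exponent_le hΔ1 (by linarith)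
      _ = Δ := Real.rpow_one Δ
  have h1 : ‖Z - Z'‖ ≤ C * C₂ ^ γ * δ ^ (γ / 2) := by
    refine hZZ'.trans ?_
    calc C * ‖(L ∘ₗ comp) Z - (L ∘ₗ comp) (Vᴴ * X₀ * V)‖ ^ γ ≤ C * (C₂ * √δ) ^ γ := by gcongr
      _ = C * C₂ ^ γ * δ ^ (γ / 2) := by
        rw [Real.mul_rpow hC₂0 (Real.sqrt_nonneg _), hpow, mul_assoc]
  have h2 : ‖comp (Z - Z')‖ ≤ ‖V‖ * ‖Vᴴ‖ * ‖Z - Z'‖ := by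
    rw [hcomp]
    calc _ ≤ ‖V‖ * ‖Z - Z'‖ * ‖Vᴴ‖ :=
          (l2_opNorm_mul _ _).trans (by gcongr; exact l2_opNorm_mul _ _)
      _ = _ := by ring
  calc ‖X - comp Z'‖ = ‖(X - comp Z) + comp (Z - Z')‖ := by
        rw [map_sub, sub_add_sub_cancel]
    _ ≤ C₁ * √|R| * √δ + ‖V‖ * ‖Vᴴ‖ * ‖Z - Z'‖ := (norm_add_le _ _).trans (add_le_add hXZ h2)
    _ ≤ C₁ * √|R| * (Δ * δ ^ (γ / 2)) + ‖V‖ * ‖Vᴴ‖ * (C * C₂ ^ γ * δ ^ (γ / 2)) := by gcongr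
    _ = _ := by ring

end ErrorBound

/-! ### Pseudo-concavity, coercivity and existence of maximizers for the energy efficiency. -/

section EnergyEfficiency

open scoped Matrix.Norms.L2Operator MatrixOrder
open Matrix

theorem Matrix.isClosed_posSemidef (n : Type*) [Fintype n] [DecidableEq n] :
    IsClosed {A : Matrix n n ℂ | A.PosSemidef} := by
  have h : {A : Matrix n n ℂ | A.PosSemidef} = {A | Aᴴ = A} ∩
      ⋂ B : {B : Matrix n n ℂ // B.PosSemidef}, {A | 0 ≤ (A * B.1).trace.re} := by
    ext A
    simp only [Set.mem_ofPred_eq, Set.mem_inter_iff, Set.mem_iInter, Subtype.forall]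
    exact ⟨fun hA => ⟨hA.1, fun B hB => hA.re_trace_mul_nonneg hB⟩,
      fun hA => posSemidef_of_re_trace_mul_nonneg hA.1 hA.2⟩
  rw [h]
  refine (isClosed_eq (by fun_prop) continuous_id).inter (isClosed_iInter fun B => ?_)
  exact isClosed_le continuous_const (Complex.continuous_re.comp
    (Continuous.matrix_trace (continuous_id.matrix_mul continuous_const)))

namespace MIMOBC

variable {K N M : ℕ} (S : MIMOBC K N M) (T : Finset (Fin M))

/-- The linear part of `macMatrix`. -/
noncomputable def linPart : CovTuple K N →ₗ[ℝ] Matrix T T ℂ where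
  toFun X := ((1 / S.σ ^ 2 : ℝ) : ℂ) •
    ∑ i, (S.activeH T i).conjTranspose * X i * S.activeH T i
  map_add' X Y := by
    simp only [Pi.add_apply, Matrix.mul_add, Matrix.add_mul, Finset.sum_add_distrib, smul_add]
  map_smul' c X := by
    simp only [Pi.smul_apply, Matrix.mul_smul, Matrix.smul_mul, ← Finset.smul_sum,
      RingHom.id_apply]
    rw [smul_comm]

theorem linPart_apply (X : CovTuple K N) : S.linPart T X = ((1 / S.σ ^ 2 : ℝ) : ℂ) •
    ∑ i, (S.activeH T i).conjTranspose * X i * S.activeH T i := rfl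

theorem macMatrix_eq (Q : CovTuple K N) : S.macMatrix T Q = 1 + S.linPart T Q := rfl

/-- The sum of the traces of all covariance matrices. -/
noncomputable def traceSum (K N : ℕ) : CovTuple K N →ₗ[ℝ] ℝ where
  toFun X := ∑ i, (X i).trace.re
  map_add' X Y := by simp [Matrix.trace_add, Finset.sum_add_distrib]
  map_smul' c X := by simp [Matrix.trace_smul, Finset.mul_sum]

theorem traceSum_apply (X : CovTuple K N) : traceSum K N X = ∑ i, (X i).trace.re := rfl

theorem totalPower_eq (Q : CovTuple K N) :
    S.totalPower T Q = traceSum K N Q / S.η + S.fixedPower T := rfl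

/-- The natural logarithm of the determinant in the rate. -/
noncomputable def logDet (Q : CovTuple K N) : ℝ := Real.log (S.macMatrix T Q).det.re

/-- The derivative of `logDet` at `Q` in direction `X`. -/
noncomputable def dirDeriv (Q X : CovTuple K N) : ℝ :=
  ((S.macMatrix T Q)⁻¹ * S.linPart T X).trace.re

/-- The bandwidth in nats. -/
noncomputable def natBandwidth : ℝ := S.W / Real.log 2

theorem natBandwidth_pos (hW : 0 < S.W) : 0 < S.natBandwidth :=
  div_pos hW (Real.log_pos one_lt_two)

theorem ee_eq (Q : CovTuple K N) :
    S.ee T Q = S.natBandwidth * S.logDet T Q / S.totalPower T Q := by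
  rw [ee, sumRate, natBandwidth, logDet, Real.logb]
  congr 1
  ring

variable {S T}

theorem linPart_posSemidef {X : CovTuple K N} (hX : X ∈ feasibleCov K N) :
    (S.linPart T X).PosSemidef := by
  rw [linPart_apply]
  refine PosSemidef.smul (posSemidef_sum _ fun i _ => (hX i).conjTranspose_mul_mul_same _) ?_
  exact_mod_cast (by positivity : (0 : ℝ) ≤ 1 / S.σ ^ 2)

theorem macMatrix_sub_one_posSemidef {Q : CovTuple K N} (hQ : Q ∈ feasibleCov K N) :
    (S.macMatrix T Q - 1).PosSemidef := by
  rw [macMatrix_eq, add_sub_cancel_left]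
  exact linPart_posSemidef hQ

theorem macMatrix_sub (Q P : CovTuple K N) :
    S.macMatrix T Q - S.macMatrix T P = S.linPart T (Q - P) := by
  rw [macMatrix_eq, macMatrix_eq, map_sub]
  abel

theorem norm_inv_macMatrix_le {Q : CovTuple K N} (hQ : Q ∈ feasibleCov K N) :
    ‖(S.macMatrix T Q)⁻¹‖ ≤ 1 :=
  inv_norm_le_one (macMatrix_sub_one_posSemidef hQ)

theorem norm_le_traceSum {Q : CovTuple K N} (hQ : Q ∈ feasibleCov K N) :
    ‖Q‖ ≤ traceSum K N Q := by
  have h0 : ∀ i, 0 ≤ (Q i).trace.re := fun i => (hQ i).re_trace_nonneg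
  have hs : 0 ≤ traceSum K N Q := by
    rw [traceSum_apply]
    exact Finset.sum_nonneg fun i _ => h0 i
  refine (pi_norm_le_iff_of_nonneg hs).2 fun i => ?_
  exact (hQ i).norm_le_re_trace.trans
    (Finset.single_le_sum (f := fun i => (Q i).trace.re) (fun j _ => h0 j) (Finset.mem_univ i))

theorem traceSum_nonneg {Q : CovTuple K N} (hQ : Q ∈ feasibleCov K N) : 0 ≤ traceSum K N Q :=
  (norm_nonneg Q).trans (norm_le_traceSum hQ)

theorem fixedPower_le_totalPower (hη : 0 < S.η) {Q : CovTuple K N} (hQ : Q ∈ feasibleCov K N) :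
    S.fixedPower T ≤ S.totalPower T Q := by
  rw [totalPower_eq]
  linarith [div_nonneg (traceSum_nonneg hQ) hη.le]

theorem totalPower_sub (Q P : CovTuple K N) :
    S.totalPower T Q = S.totalPower T P + traceSum K N (Q - P) / S.η := by
  rw [totalPower_eq, totalPower_eq, map_sub]
  ring

theorem det_macMatrix_pos {Q : CovTuple K N} (hQ : Q ∈ feasibleCov K N) :
    0 < (S.macMatrix T Q).det.re :=
  (Complex.pos_iff.1 (PosDef.of_sub_one (macMatrix_sub_one_posSemidef hQ)).det_pos).1

theorem convex_feasibleCov : Convex ℝ (feasibleCov K N) :=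
  fun _ hX _ hY _ _ ha hb _ i => ((hX i).smul ha).add ((hY i).smul hb)

theorem isClosed_feasibleCov : IsClosed (feasibleCov K N) := by
  have : feasibleCov K N =
      ⋂ i, (fun Q : CovTuple K N => Q i) ⁻¹' {A : Matrix (Fin N) (Fin N) ℂ | A.PosSemidef} := by
    ext Q
    simp [feasibleCov]
  rw [this]
  exact isClosed_iInter fun i => (isClosed_posSemidef _).preimage (continuous_apply i)

/-- The remainder in the tangent inequality for `logDet`. -/
noncomputable def remainder (S : MIMOBC K N M) (T : Finset (Fin M)) (P Q : CovTuple K N) : ℝ :=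
  ‖S.linPart T (Q - P)‖ ^ 2 / (2 * ‖S.macMatrix T P‖ ^ 2 * (‖S.macMatrix T Q‖ + 1))

theorem remainder_nonneg (P Q : CovTuple K N) : 0 ≤ S.remainder T P Q := by
  rw [remainder]; positivity

theorem logDet_le {P Q : CovTuple K N} (hP : P ∈ feasibleCov K N) (hQ : Q ∈ feasibleCov K N) :
    S.logDet T Q ≤ S.logDet T P + S.dirDeriv T P (Q - P) - S.remainder T P Q := by
  have h := log_det_le_add_trace (macMatrix_sub_one_posSemidef (S := S) (T := T) hP)
    (PosDef.of_sub_one (macMatrix_sub_one_posSemidef (S := S) (T := T) hQ))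
  rwa [macMatrix_sub] at h

theorem ee_mul_totalPower (hη : 0 < S.η) (hP : 0 < S.fixedPower T) {Q : CovTuple K N}
    (hQ : Q ∈ feasibleCov K N) :
    S.ee T Q * S.totalPower T Q = S.natBandwidth * S.logDet T Q := by
  rw [ee_eq, div_mul_cancel₀]
  exact (hP.trans_le (fixedPower_le_totalPower hη hQ)).ne.symm

/-- The tangent inequality for the pseudo-concave function `ee`. -/
theorem totalPower_mul_ee_sub_le (hW : 0 < S.W) (hη : 0 < S.η) (hp : 0 < S.fixedPower T)
    {P Q : CovTuple K N} (hP : P ∈ feasibleCov K N) (hQ : Q ∈ feasibleCov K N) :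
    S.totalPower T Q * (S.ee T Q - S.ee T P) + S.natBandwidth * S.remainder T P Q ≤
      S.natBandwidth * S.dirDeriv T P (Q - P) - S.ee T P / S.η * traceSum K N (Q - P) := by
  have h1 := mul_le_mul_of_nonneg_left (logDet_le (S := S) (T := T) hP hQ)
    (S.natBandwidth_pos hW).le
  have h2 := ee_mul_totalPower (T := T) hη hp hQ
  have h3 := ee_mul_totalPower (T := T) hη hp hP
  have h4 := totalPower_sub (S := S) (T := T) Q P
  -- Dinkelbach's device: with the ratio frozen at P, rate minus ratio times power is concave and
  -- vanishes at P.
  have h5 : S.totalPower T Q * S.ee T P = S.natBandwidth * S.logDet T P +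
      S.ee T P / S.η * traceSum K N (Q - P) := by
    rw [h4, ← h3]
    ring
  nlinarith

theorem continuous_linPart : Continuous (S.linPart T) :=
  LinearMap.continuous_of_finiteDimensional _

theorem continuous_traceSum : Continuous (traceSum K N) :=
  LinearMap.continuous_of_finiteDimensional _

theorem continuous_macMatrix : Continuous (S.macMatrix T) :=
  continuous_const.add continuous_linPart

theorem continuousOn_ee (hη : 0 < S.η) (hp : 0 < S.fixedPower T) :
    ContinuousOn (S.ee T) (feasibleCov K N) := by
  have h : S.ee T = fun Q => S.natBandwidth * S.logDet T Q / S.totalPower T Q := by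
    ext Q
    exact S.ee_eq T Q
  rw [h]
  refine ContinuousOn.div (continuousOn_const.mul ?_) ?_ fun Q hQ =>
    (hp.trans_le (fixedPower_le_totalPower hη hQ)).ne'
  · refine ContinuousOn.log ?_ fun Q hQ => (det_macMatrix_pos hQ).ne'
    exact (Complex.continuous_re.comp continuous_macMatrix.matrix_det).continuousOn
  · exact ((continuous_traceSum.div_const _).add continuous_const).continuousOn

theorem exists_norm_linPart_le (S : MIMOBC K N M) (T : Finset (Fin M)) :
    ∃ C : ℝ, 0 ≤ C ∧ ∀ X, ‖S.linPart T X‖ ≤ C * ‖X‖ :=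
  ⟨‖LinearMap.toContinuousLinearMap (S.linPart T)‖, norm_nonneg _,
    (LinearMap.toContinuousLinearMap (S.linPart T)).le_opNorm⟩

theorem exists_abs_traceSum_le (K N : ℕ) :
    ∃ C : ℝ, 0 ≤ C ∧ ∀ X, |traceSum K N X| ≤ C * ‖X‖ :=
  ⟨‖LinearMap.toContinuousLinearMap (traceSum K N)‖, norm_nonneg _,
    (LinearMap.toContinuousLinearMap (traceSum K N)).le_opNorm⟩

theorem exists_abs_dirDeriv_le (S : MIMOBC K N M) (T : Finset (Fin M)) :
    ∃ C : ℝ, 0 ≤ C ∧ ∀ Q ∈ feasibleCov K N, ∀ X,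
      |S.dirDeriv T Q X| ≤ C * ‖S.linPart T X‖ := by
  obtain ⟨C, hC, h⟩ := exists_abs_re_trace_le T
  refine ⟨C, hC, fun Q hQ X => (h _).trans ?_⟩
  gcongr
  refine (norm_mul_le _ _).trans ?_
  exact mul_le_of_le_one_left (norm_nonneg _) (norm_inv_macMatrix_le hQ)

theorem abs_dirDeriv_sub_le (S : MIMOBC K N M) (T : Finset (Fin M)) :
    ∃ C : ℝ, 0 ≤ C ∧ ∀ P ∈ feasibleCov K N, ∀ Q ∈ feasibleCov K N, ∀ X,
      |S.dirDeriv T P X - S.dirDeriv T Q X| ≤ C * ‖P - Q‖ * ‖X‖ := by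
  obtain ⟨C, hC, h⟩ := exists_abs_re_trace_le T
  obtain ⟨l, hl, hL⟩ := S.exists_norm_linPart_le T
  refine ⟨C * l * l, by positivity, fun P hP Q hQ X => ?_⟩
  have h1 : S.dirDeriv T P X - S.dirDeriv T Q X =
      (((S.macMatrix T P)⁻¹ - (S.macMatrix T Q)⁻¹) * S.linPart T X).trace.re := by
    rw [Matrix.sub_mul, trace_sub, Complex.sub_re]
    rfl
  rw [h1]
  calc _ ≤ C * (‖(S.macMatrix T P)⁻¹ - (S.macMatrix T Q)⁻¹‖ * ‖S.linPart T X‖) :=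
        (h _).trans (by gcongr; exact norm_mul_le _ _)
    _ ≤ C * ((l * ‖P - Q‖) * (l * ‖X‖)) := by
        gcongr
        · refine (norm_inv_sub_inv_le (macMatrix_sub_one_posSemidef hP)
            (macMatrix_sub_one_posSemidef hQ)).trans ?_
          rw [macMatrix_sub]
          exact hL _
        · exact hL _
    _ = _ := by ring

theorem dirDeriv_smul (Q X : CovTuple K N) (c : ℝ) :
    S.dirDeriv T Q (c • X) = c * S.dirDeriv T Q X := by
  rw [dirDeriv, map_smul, Matrix.mul_smul, trace_smul, Complex.real_smul, Complex.re_ofReal_mul,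
    dirDeriv]

/-- First-order optimality along a segment. -/
theorem dirDeriv_le_of_forall_ee_le (hW : 0 < S.W) (hη : 0 < S.η) (hp : 0 < S.fixedPower T)
    {P Q : CovTuple K N} (hP : P ∈ feasibleCov K N) (hQ : Q ∈ feasibleCov K N)
    (h : ∀ t : ℝ, 0 < t → t ≤ 1 → S.ee T (P + t • (Q - P)) ≤ S.ee T P) :
    S.natBandwidth * S.dirDeriv T P (Q - P) ≤ S.ee T P / S.η * traceSum K N (Q - P) := by
  have hmem : ∀ t : ℝ, 0 ≤ t → t ≤ 1 → P + t • (Q - P) ∈ feasibleCov K N := fun t h0 h1 =>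
    convex_feasibleCov.add_smul_sub_mem hP hQ ⟨h0, h1⟩
  -- Nothing is differentiated: the tangent inequality based at the point of parameter t and
  -- evaluated at P is divided by t, and continuity gives the limit t → 0.
  have key : ∀ t : ℝ, 0 < t → t ≤ 1 → S.natBandwidth * S.dirDeriv T (P + t • (Q - P)) (Q - P) ≤
      S.ee T (P + t • (Q - P)) / S.η * traceSum K N (Q - P) := fun t h0 h1 => by
    have hm := totalPower_mul_ee_sub_le hW hη hp (hmem t h0.le h1) hP
    have hneg : P - (P + t • (Q - P)) = (-t) • (Q - P) := by
      rw [neg_smul]; abel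
    rw [hneg, dirDeriv_smul, map_smul, smul_eq_mul] at hm
    have h2 : 0 ≤ S.totalPower T P * (S.ee T P - S.ee T (P + t • (Q - P))) :=
      mul_nonneg (hp.trans_le (fixedPower_le_totalPower hη hP)).le (sub_nonneg.2 (h t h0 h1))
    have h3 := mul_nonneg (S.natBandwidth_pos hW).le
      (remainder_nonneg (S := S) (T := T) (P + t • (Q - P)) P)
    by_contra! hcon
    nlinarith [mul_lt_mul_of_pos_left hcon h0]
  have hev : ∀ᶠ t : ℝ in 𝓝[>] 0, 0 < t ∧ t ≤ 1 :=
    (eventually_mem_nhdsWithin).and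
      (mem_nhdsWithin_of_mem_nhds (Iic_mem_nhds one_pos))
  have hcont : Tendsto (fun t : ℝ => P + t • (Q - P)) (𝓝[>] 0) (𝓝[feasibleCov K N] P) := by
    refine tendsto_nhdsWithin_iff.2 ⟨?_, hev.mono fun t ht => hmem t ht.1.le ht.2⟩
    have : Continuous fun t : ℝ => P + t • (Q - P) := by fun_prop
    have h0 := this.tendsto 0
    simp only [zero_smul, add_zero] at h0
    exact h0.mono_left nhdsWithin_le_nhds
  have hd : ContinuousWithinAt (fun R => S.dirDeriv T R (Q - P)) (feasibleCov K N) P := by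
    obtain ⟨C, hC, hl⟩ := S.abs_dirDeriv_sub_le T
    rw [ContinuousWithinAt, tendsto_iff_dist_tendsto_zero]
    refine squeeze_zero' (.of_forall fun _ => dist_nonneg)
      (eventually_mem_nhdsWithin.mono fun R hR => hl R hR P hP (Q - P)) ?_
    have : Continuous fun R : CovTuple K N => C * ‖R - P‖ * ‖Q - P‖ := by fun_prop
    have h0 := this.tendsto P
    simp only [sub_self, norm_zero, mul_zero, zero_mul] at h0
    exact h0.mono_left nhdsWithin_le_nhds
  have he := (continuousOn_ee (T := T) hη hp) P hP
  refine le_of_tendsto_of_tendsto ((hd.tendsto.comp hcont).const_mul S.natBandwidth)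
    (((he.tendsto.comp hcont).div_const S.η).mul_const _)
    (hev.mono fun t ht => key t ht.1 ht.2)

theorem logDet_nonneg {Q : CovTuple K N} (hQ : Q ∈ feasibleCov K N) : 0 ≤ S.logDet T Q := by
  have h := logDet_le (S := S) (T := T) hQ (show (0 : CovTuple K N) ∈ feasibleCov K N from
    fun _ => PosSemidef.zero)
  have h0 : S.logDet T 0 = 0 := by simp [logDet, macMatrix_eq]
  have h1 : S.dirDeriv T Q (0 - Q) = -S.dirDeriv T Q Q := by
    rw [zero_sub, ← neg_one_smul ℝ, dirDeriv_smul]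
    ring
  have h2 : 0 ≤ S.dirDeriv T Q Q :=
    (PosDef.of_sub_one (macMatrix_sub_one_posSemidef hQ)).inv.posSemidef.re_trace_mul_nonneg
      (linPart_posSemidef hQ)
  have h3 := remainder_nonneg (S := S) (T := T) Q 0
  linarith

theorem norm_macMatrix_pos [Nonempty T] {Q : CovTuple K N} (hQ : Q ∈ feasibleCov K N) :
    0 < ‖S.macMatrix T Q‖ := by
  rw [norm_pos_iff]
  intro h
  have := det_macMatrix_pos (S := S) (T := T) hQ
  rw [h, Matrix.det_zero] at this
  simp at this

theorem ee_nonneg (hW : 0 < S.W) (hη : 0 < S.η) (hp : 0 < S.fixedPower T)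
    {Q : CovTuple K N} (hQ : Q ∈ feasibleCov K N) : 0 ≤ S.ee T Q := by
  rw [ee_eq]
  exact div_nonneg (mul_nonneg (S.natBandwidth_pos hW).le (logDet_nonneg hQ))
    (hp.le.trans (fixedPower_le_totalPower hη hQ))

/-- The tangent inequality based at Q and evaluated at 0 bounds `logDet` below by the remainder,
which is positive when `linPart` does not vanish. -/
theorem ee_pos (hW : 0 < S.W) (hη : 0 < S.η) (hp : 0 < S.fixedPower T)
    {Q : CovTuple K N} (hQ : Q ∈ feasibleCov K N) (h0 : S.linPart T Q ≠ 0) : 0 < S.ee T Q := by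
  have hne : Nonempty T := by
    by_contra hT
    rw [not_nonempty_iff] at hT
    exact h0 (Subsingleton.elim _ _)
  rw [ee_eq]
  refine div_pos (mul_pos (S.natBandwidth_pos hW) ?_)
    (hp.trans_le (fixedPower_le_totalPower hη hQ))
  have h := logDet_le (S := S) (T := T) hQ (show (0 : CovTuple K N) ∈ feasibleCov K N from
    fun _ => PosSemidef.zero)
  have h0' : S.logDet T 0 = 0 := by simp [logDet, macMatrix_eq]
  have h1 : S.dirDeriv T Q (0 - Q) = -S.dirDeriv T Q Q := by
    rw [zero_sub, ← neg_one_smul ℝ, dirDeriv_smul]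
    ring
  have h2 : 0 ≤ S.dirDeriv T Q Q :=
    (PosDef.of_sub_one (macMatrix_sub_one_posSemidef hQ)).inv.posSemidef.re_trace_mul_nonneg
      (linPart_posSemidef hQ)
  have h3 : 0 < S.remainder T Q 0 := by
    have h4 := norm_macMatrix_pos (S := S) (T := T) hQ
    have h5 : 0 < ‖S.linPart T (0 - Q)‖ := by
      rw [zero_sub, map_neg, norm_neg]
      exact norm_pos_iff.2 h0
    rw [remainder]
    exact div_pos (pow_pos h5 2) (mul_pos (mul_pos two_pos (pow_pos h4 2))
      (add_pos_of_nonneg_of_pos (norm_nonneg _) one_pos))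
  linarith

/-- The tangent of `log det` at c · 1 has slope 1/c, which is as small as desired for large c. -/
theorem exists_logDet_le (S : MIMOBC K N M) (T : Finset (Fin M)) {ε : ℝ} (hε : 0 < ε) :
    ∃ D : ℝ, 0 ≤ D ∧ ∀ Q ∈ feasibleCov K N, S.logDet T Q ≤ D + ε * traceSum K N Q := by
  obtain ⟨C, hC, h⟩ := exists_abs_re_trace_le T
  obtain ⟨l, hl, hL⟩ := S.exists_norm_linPart_le T
  set c : ℝ := 1 + C * l / ε with hc
  have hc1 : 1 ≤ c := by rw [hc]; linarith [show 0 ≤ C * l / ε by positivity]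
  have hc0 : 0 < c := by linarith
  have hcε : c⁻¹ * (C * l) ≤ ε := by
    rw [inv_mul_le_iff₀ hc0, hc, add_mul, div_mul_cancel₀ _ hε.ne']
    linarith
  refine ⟨|Real.log ((c • (1 : Matrix T T ℂ)).det.re)| + C * ‖c⁻¹ • (1 : Matrix T T ℂ) - 1‖,
    by positivity, fun Q hQ => ?_⟩
  have hA : (c • (1 : Matrix T T ℂ) - 1).PosSemidef := by
    have : c • (1 : Matrix T T ℂ) - 1 = (c - 1) • (1 : Matrix T T ℂ) := by
      rw [sub_smul, one_smul]
    rw [this]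
    exact PosSemidef.one.smul (sub_nonneg.2 hc1)
  have h1 := log_det_le_add_trace hA
    (PosDef.of_sub_one (macMatrix_sub_one_posSemidef (S := S) (T := T) hQ))
  have hinv : (c • (1 : Matrix T T ℂ))⁻¹ = c⁻¹ • 1 := by
    refine inv_eq_right_inv ?_
    rw [smul_mul_smul_comm, mul_inv_cancel₀ hc0.ne', one_smul, one_mul]
  have h2 : (c • (1 : Matrix T T ℂ))⁻¹ * (S.macMatrix T Q - c • 1) =
      c⁻¹ • S.linPart T Q + (c⁻¹ • (1 : Matrix T T ℂ) - 1) := by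
    rw [hinv, macMatrix_eq, smul_mul_assoc, one_mul, smul_sub, smul_add, smul_smul,
      inv_mul_cancel₀ hc0.ne', one_smul]
    abel
  rw [h2, trace_add, Complex.add_re, trace_smul, Complex.real_smul, Complex.re_ofReal_mul] at h1
  have h3 : c⁻¹ * (S.linPart T Q).trace.re ≤ ε * traceSum K N Q := by
    calc c⁻¹ * (S.linPart T Q).trace.re ≤ c⁻¹ * (C * (l * traceSum K N Q)) := by
          gcongr
          refine (le_abs_self _).trans ((h _).trans ?_)
          gcongr
          exact (hL Q).trans (by gcongr; exact norm_le_traceSum hQ)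
      _ = c⁻¹ * (C * l) * traceSum K N Q := by ring
      _ ≤ ε * traceSum K N Q := by
          gcongr
          exact traceSum_nonneg hQ
  have h4 := (le_abs_self _).trans (h (c⁻¹ • (1 : Matrix T T ℂ) - 1))
  have h5 := le_abs_self (Real.log ((c • (1 : Matrix T T ℂ)).det.re))
  have h6 : 0 ≤ ‖S.macMatrix T Q - c • 1‖ ^ 2 /
    (2 * ‖c • (1 : Matrix T T ℂ)‖ ^ 2 * (‖S.macMatrix T Q‖ + 1)) := by positivity
  rw [logDet]
  linarith

/-- Coercivity: the slope ε is chosen so that the rate uses up at most half of the power term α ·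
trace / η. -/
theorem exists_traceSum_le_of_le_ee (hW : 0 < S.W) (hη : 0 < S.η) (hp : 0 < S.fixedPower T)
    {α : ℝ} (hα : 0 < α) :
    ∃ R : ℝ, 0 ≤ R ∧ ∀ Q ∈ feasibleCov K N, α ≤ S.ee T Q → traceSum K N Q ≤ R := by
  have hκ := S.natBandwidth_pos hW
  obtain ⟨D, hD, h⟩ := S.exists_logDet_le T (ε := α / (2 * S.η * S.natBandwidth)) (by positivity)
  refine ⟨2 * S.η * S.natBandwidth * D / α, by positivity, fun Q hQ hle => ?_⟩
  have h1 := ee_mul_totalPower (T := T) hη hp hQ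
  have h2 := mul_le_mul_of_nonneg_left (h Q hQ) hκ.le
  have h3 : α * (traceSum K N Q / S.η) ≤ S.ee T Q * S.totalPower T Q := by
    have := div_nonneg (traceSum_nonneg hQ) hη.le
    refine mul_le_mul hle ?_ this (hα.le.trans hle)
    rw [totalPower_eq]
    linarith
  rw [le_div_iff₀ hα]
  have h4 : S.natBandwidth * (D + α / (2 * S.η * S.natBandwidth) * traceSum K N Q) =
      S.natBandwidth * D + α * (traceSum K N Q / S.η) / 2 := by
    field_simp
  rw [h4] at h2
  have h5 : α * (traceSum K N Q / S.η) ≤ 2 * (S.natBandwidth * D) := by linarith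
  have h6 : traceSum K N Q * α = S.η * (α * (traceSum K N Q / S.η)) := by field_simp
  rw [h6]
  nlinarith [mul_le_mul_of_nonneg_left h5 hη.le]

/-- The superlevel set through Q₀ is compact. The general closed set serves both the block problems
and the full one. -/
theorem exists_isMaxOn_of_isClosed (hW : 0 < S.W) (hη : 0 < S.η) (hp : 0 < S.fixedPower T)
    {C : Set (CovTuple K N)} (hC : IsClosed C) (hCf : C ⊆ feasibleCov K N)
    {Q₀ : CovTuple K N} (hQ₀ : Q₀ ∈ C) (h0 : 0 < S.ee T Q₀) :
    ∃ Q ∈ C, ∀ Q' ∈ C, S.ee T Q' ≤ S.ee T Q := by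
  obtain ⟨R, hR, hbd⟩ := exists_traceSum_le_of_le_ee (S := S) (T := T) hW hη hp h0
  have hcont := (continuousOn_ee (T := T) hη hp).mono hCf
  have hcl : IsClosed (C ∩ S.ee T ⁻¹' Set.Ici (S.ee T Q₀)) :=
    hcont.preimage_isClosed_of_isClosed hC isClosed_Ici
  have hb : Bornology.IsBounded (C ∩ S.ee T ⁻¹' Set.Ici (S.ee T Q₀)) := by
    refine (Metric.isBounded_closedBall (x := (0 : CovTuple K N)) (r := R)).subset fun Q hQ => ?_
    rw [mem_closedBall_zero_iff]
    exact (norm_le_traceSum (hCf hQ.1)).trans (hbd Q (hCf hQ.1) hQ.2)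
  have : ProperSpace (CovTuple K N) := FiniteDimensional.proper ℂ _
  obtain ⟨Q, hQ, hmax⟩ := (Metric.isCompact_of_isClosed_isBounded hcl hb).exists_isMaxOn
    ⟨Q₀, hQ₀, le_refl (S.ee T Q₀)⟩ (hcont.mono Set.inter_subset_left)
  refine ⟨Q, hQ.1, fun Q' hQ' => ?_⟩
  by_cases h : S.ee T Q₀ ≤ S.ee T Q'
  · exact hmax ⟨hQ', h⟩
  · exact (not_le.1 h).le.trans (hmax ⟨hQ₀, le_refl (S.ee T Q₀)⟩)

end MIMOBC

end EnergyEfficiency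

/-- Finite length from sufficient decrease and a Łojasiewicz-type inequality. -/
theorem summable_of_sufficient_decrease {r d : ℕ → ℝ} {c C γ : ℝ} (hc : 0 < c) (hC : 0 ≤ C)
    (hγ : 0 < γ) (hγ1 : γ ≤ 1) (hr : ∀ k, 0 ≤ r k) (hd : ∀ k, 0 ≤ d k)
    (h1 : ∀ k, c * d k ^ 2 ≤ r k - r (k + 1))
    (h2 : ∀ k, r (k + 1) ≤ C * d k * r (k + 1) ^ γ) : Summable d := by
  set D := C / (γ * c) with hD
  have hD0 : 0 ≤ D := by positivity
  -- Concavity of x^γ turns the decrease into a^γ - b^γ ≥ γ a^(γ-1) c d(k+1)², and the second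
  -- hypothesis bounds a^(1-γ) by C d(k). The product bound for d(k+1)² is then split into a sum.
  have key : ∀ k, d (k + 1) ≤ d k / 2 + D * (r (k + 1) ^ γ - r (k + 2) ^ γ) := fun k => by
    have h3 := h1 (k + 1)
    have hba : r (k + 2) ≤ r (k + 1) := by nlinarith [sq_nonneg (d (k + 1))]
    have hφ : r (k + 2) ^ γ ≤ r (k + 1) ^ γ := Real.rpow_le_rpow (hr _) hba hγ.le
    rcases (hr (k + 1)).eq_or_lt with h0 | h0
    · have h4 : c * d (k + 1) ^ 2 ≤ 0 := by linarith [hr (k + 1 + 1)]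
      have h5 : d (k + 1) = 0 := by
        have : d (k + 1) ^ 2 ≤ 0 := by
          by_contra! h
          linarith [mul_pos hc h]
        exact pow_eq_zero_iff two_ne_zero |>.1 (le_antisymm this (sq_nonneg _))
      rw [h5]
      have := mul_nonneg hD0 (sub_nonneg.2 hφ)
      linarith [hd k]
    · have h4 := h2 k
      have hrk := hr (k + 2)
      set a := r (k + 1)
      set b := r (k + 2)
      have hbern : (b / a) ^ γ ≤ 1 + γ * (b / a - 1) := by
        have := rpow_one_add_le_one_add_mul_self (s := b / a - 1) (p := γ)
          (by linarith [div_nonneg hrk h0.le]) hγ.le hγ1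
        rwa [add_sub_cancel] at this
      have haγ : 0 < a ^ γ := Real.rpow_pos_of_pos h0 γ
      rw [Real.div_rpow hrk h0.le, div_le_iff₀ haγ] at hbern
      have h5 : γ * a ^ γ * (a - b) ≤ a * (a ^ γ - b ^ γ) := by
        have h6 : (1 + γ * (b / a - 1)) * a ^ γ = a ^ γ - γ * a ^ γ * (a - b) / a := by
          field_simp
          ring
        rw [h6] at hbern
        have h7 : γ * a ^ γ * (a - b) / a ≤ a ^ γ - b ^ γ := by linarith
        rw [div_le_iff₀ h0] at h7
        linarith
      have h8 : γ * a ^ γ * (c * d (k + 1) ^ 2) ≤ C * d k * a ^ γ * (a ^ γ - b ^ γ) :=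
        calc γ * a ^ γ * (c * d (k + 1) ^ 2) ≤ γ * a ^ γ * (a - b) := by gcongr
          _ ≤ a * (a ^ γ - b ^ γ) := h5
          _ ≤ _ := mul_le_mul_of_nonneg_right h4 (sub_nonneg.2 hφ)
      have h9 : γ * c * d (k + 1) ^ 2 ≤ C * (d k * (a ^ γ - b ^ γ)) := by
        refine le_of_mul_le_mul_left ?_ haγ
        calc a ^ γ * (γ * c * d (k + 1) ^ 2) = γ * a ^ γ * (c * d (k + 1) ^ 2) := by ring
          _ ≤ _ := h8
          _ = _ := by ring
      have h10 : d (k + 1) ^ 2 ≤ D * (d k * (a ^ γ - b ^ γ)) := by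
        rw [hD, div_mul_eq_mul_div, le_div_iff₀ (by positivity)]
        linarith
      have hψ := sub_nonneg.2 hφ
      refine abs_le_of_sq_le_sq' ?_ (add_nonneg (div_nonneg (hd k) two_pos.le)
        (mul_nonneg hD0 hψ)) |>.2
      nlinarith [sq_nonneg (d k / 2), sq_nonneg (D * (a ^ γ - b ^ γ))]
  -- The extra d(n) on the left pays for the term d(n) of the doubled recursion, and the powers of r
  -- telescope.
  have hsum : ∀ n, ∑ k ∈ Finset.range (n + 1), d k + d n ≤
      2 * d 0 + 2 * D * (r 1 ^ γ - r (n + 1) ^ γ) := by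
    intro n
    induction n with
    | zero => simp; linarith
    | succ n ih =>
      rw [Finset.sum_range_succ]
      have := key n
      linarith
  refine summable_of_sum_range_le (c := 2 * d 0 + 2 * D * r 1 ^ γ) hd fun n => ?_
  have h3 := hsum n
  rw [Finset.sum_range_succ] at h3
  have h4 : 0 ≤ 2 * D * r (n + 1) ^ γ := mul_nonneg (by positivity) (Real.rpow_nonneg (hr _) _)
  linarith [hd n]

/-! ### Optimality conditions for a single block. -/

section BlockMaximizers

open scoped Matrix.Norms.L2Operator MatrixOrder
open Matrix

namespace MIMOBC

variable {K N M : ℕ} {S : MIMOBC K N M} {T : Finset (Fin M)}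

theorem update_mem_feasibleCov {Q : CovTuple K N} (hQ : Q ∈ feasibleCov K N) (i : Fin K)
    {A : Matrix (Fin N) (Fin N) ℂ} (hA : A.PosSemidef) :
    Function.update Q i A ∈ feasibleCov K N := by
  intro j
  rcases eq_or_ne j i with rfl | hj
  · simpa using hA
  · simpa [hj] using hQ j

theorem update_sub_update (Q : CovTuple K N) (i : Fin K) (A B : Matrix (Fin N) (Fin N) ℂ) :
    Function.update Q i B - Function.update Q i A = Pi.single i (B - A) := by
  ext1 j
  rcases eq_or_ne j i with rfl | hj
  · simp
  · simp [hj]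

theorem linPart_single (i : Fin K) (X : Matrix (Fin N) (Fin N) ℂ) :
    S.linPart T (Pi.single i X) =
      ((1 / S.σ ^ 2 : ℝ) : ℂ) • ((S.activeH T i)ᴴ * X * S.activeH T i) := by
  rw [linPart_apply, Finset.sum_eq_single i]
  · simp
  · intro j _ hj
    simp [hj]
  · simp

theorem traceSum_single (i : Fin K) (X : Matrix (Fin N) (Fin N) ℂ) :
    traceSum K N (Pi.single i X) = X.trace.re := by
  rw [traceSum_apply, Finset.sum_eq_single i]
  · simp
  · intro j _ hj
    simp [hj]
  · simp

theorem dirDeriv_eq_sum (Q X : CovTuple K N) :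
    S.dirDeriv T Q X = ∑ i, S.dirDeriv T Q (Pi.single i (X i)) := by
  have h : X = ∑ i, Pi.single i (X i) := (Finset.univ_sum_single X).symm
  conv_lhs => rw [h]
  simp only [dirDeriv, map_sum, Matrix.mul_sum, trace_sum, Complex.re_sum]

variable (S T) in
/-- The gradient of `logDet` with respect to the covariance of user `i`. -/
noncomputable def blockGrad (Q : CovTuple K N) (i : Fin K) : Matrix (Fin N) (Fin N) ℂ :=
  (1 / S.σ ^ 2 : ℝ) • (S.activeH T i * (S.macMatrix T Q)⁻¹ * (S.activeH T i)ᴴ)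

theorem dirDeriv_single (Q : CovTuple K N) (i : Fin K) (X : Matrix (Fin N) (Fin N) ℂ) :
    S.dirDeriv T Q (Pi.single i X) = (S.blockGrad T Q i * X).trace.re := by
  rw [dirDeriv, linPart_single, blockGrad, Complex.coe_smul, Matrix.mul_smul, Matrix.smul_mul,
    trace_smul, trace_smul]
  congr 2
  rw [← Matrix.mul_assoc, trace_mul_comm]
  simp only [Matrix.mul_assoc]

theorem blockGrad_isHermitian {Q : CovTuple K N} (hQ : Q ∈ feasibleCov K N) (i : Fin K) :
    (S.blockGrad T Q i).IsHermitian := by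
  have h := (PosDef.of_sub_one (macMatrix_sub_one_posSemidef (S := S) (T := T) hQ)).inv.1
  rw [Matrix.IsHermitian, blockGrad, conjTranspose_smul, star_trivial, conjTranspose_mul,
    conjTranspose_mul, conjTranspose_conjTranspose, h.eq, Matrix.mul_assoc]

/-- Semidefinite contributions cannot cancel, so the nonzero channel of user i stays visible. This
supplies competitors with positive `ee`. -/
theorem linPart_update_one_ne_zero (hσ : 0 < S.σ) (hH : ∀ i, S.activeH T i ≠ 0)
    {Q : CovTuple K N} (hQ : Q ∈ feasibleCov K N) (i : Fin K) :
    S.linPart T (Function.update Q i 1) ≠ 0 := by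
  intro h
  set Q' := Function.update Q i 1
  have hQ' : Q' ∈ feasibleCov K N := update_mem_feasibleCov hQ i PosSemidef.one
  rw [linPart_apply, smul_eq_zero_iff_right (by
    have : (1 / S.σ ^ 2 : ℝ) ≠ 0 := by positivity
    exact_mod_cast this)] at h
  have hps : ∀ j, ((S.activeH T j)ᴴ * Q' j * S.activeH T j).PosSemidef := fun j =>
    (hQ' j).conjTranspose_mul_mul_same _
  have htr := congrArg (fun A : Matrix T T ℂ => A.trace.re) h
  simp only [trace_sum, Complex.re_sum, trace_zero, Complex.zero_re] at htr
  rw [Finset.sum_eq_zero_iff_of_nonneg fun j _ => (hps j).re_trace_nonneg] at htr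
  have h1 := (hps i).re_trace_eq_zero_iff.1 (htr i (Finset.mem_univ i))
  have h2 : Q' i = 1 := Function.update_self ..
  rw [h2, Matrix.mul_one] at h1
  exact hH i (conjTranspose_mul_self_eq_zero.1 h1)

namespace IsBlockMaximizer

variable {Q : CovTuple K N} {i : Fin K} {A : Matrix (Fin N) (Fin N) ℂ}

theorem ee_pos (hσ : 0 < S.σ) (hW : 0 < S.W) (hη : 0 < S.η) (hp : 0 < S.fixedPower T)
    (hH : ∀ i, S.activeH T i ≠ 0) (hQ : Q ∈ feasibleCov K N) (hA : S.IsBlockMaximizer T i Q A) :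
    0 < S.ee T (Function.update Q i A) :=
  (MIMOBC.ee_pos hW hη hp (update_mem_feasibleCov hQ i PosSemidef.one)
    (linPart_update_one_ne_zero hσ hH hQ i)).trans_le (hA.2 1 PosSemidef.one)

theorem dirDeriv_le (hW : 0 < S.W) (hη : 0 < S.η) (hp : 0 < S.fixedPower T)
    (hQ : Q ∈ feasibleCov K N) (hA : S.IsBlockMaximizer T i Q A)
    {B : Matrix (Fin N) (Fin N) ℂ} (hB : B.PosSemidef) :
    S.natBandwidth * S.dirDeriv T (Function.update Q i A) (Pi.single i (B - A)) ≤
      S.ee T (Function.update Q i A) / S.η * (B - A).trace.re := by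
  have h := dirDeriv_le_of_forall_ee_le (S := S) (T := T) hW hη hp
    (update_mem_feasibleCov hQ i hA.1) (update_mem_feasibleCov hQ i hB) fun t h0 h1 => by
      have h2 : Function.update Q i A + t • (Function.update Q i B - Function.update Q i A) =
          Function.update Q i ((1 - t) • A + t • B) := by
        ext1 j
        rcases eq_or_ne j i with rfl | hj
        · simp only [Pi.add_apply, Pi.smul_apply, Pi.sub_apply, Function.update_self, smul_sub,
            sub_smul, one_smul]
          abel
        · simp [hj]
      rw [h2]
      exact hA.2 _ ((hA.1.smul (sub_nonneg.2 h1)).add (hB.smul h0.le))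
  rwa [update_sub_update, traceSum_single] at h

/-- Karush-Kuhn-Tucker condition: testing the first-order inequality at A + B makes the multiplier G
positive semidefinite, and testing it at 0 gives G A = 0. -/
theorem smul_eq_blockGrad_mul (hW : 0 < S.W) (hη : 0 < S.η) (hp : 0 < S.fixedPower T)
    (hQ : Q ∈ feasibleCov K N) (hA : S.IsBlockMaximizer T i Q A) :
    (S.ee T (Function.update Q i A) / S.η) • A =
      S.natBandwidth • (S.blockGrad T (Function.update Q i A) i * A) := by
  have hP := update_mem_feasibleCov hQ i hA.1
  set P := Function.update Q i A with hPdef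
  set l := S.ee T P / S.η with hl
  set G : Matrix (Fin N) (Fin N) ℂ := l • 1 - S.natBandwidth • S.blockGrad T P i with hG
  have htr : ∀ X, (G * X).trace.re =
      l * X.trace.re - S.natBandwidth * S.dirDeriv T P (Pi.single i X) := fun X => by
    rw [hG, Matrix.sub_mul, Matrix.smul_mul, Matrix.smul_mul, Matrix.one_mul, trace_sub,
      trace_smul, trace_smul, dirDeriv_single, Complex.sub_re, Complex.real_smul,
      Complex.real_smul, Complex.re_ofReal_mul, Complex.re_ofReal_mul]
  have hfoc : ∀ B : Matrix (Fin N) (Fin N) ℂ, B.PosSemidef → 0 ≤ (G * (B - A)).trace.re :=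
    fun B hB => by
      rw [htr]
      exact sub_nonneg.2 (hA.dirDeriv_le hW hη hp hQ hB)
  have hGH : G.IsHermitian := by
    rw [Matrix.IsHermitian, hG, conjTranspose_sub, conjTranspose_smul, conjTranspose_smul,
      star_trivial, star_trivial, conjTranspose_one, (blockGrad_isHermitian hP i).eq]
  have hGP : G.PosSemidef := posSemidef_of_re_trace_mul_nonneg hGH fun B hB => by
    have := hfoc (A + B) (hA.1.add hB)
    rwa [add_sub_cancel_left] at this
  have h0 := hfoc 0 PosSemidef.zero
  rw [zero_sub, Matrix.mul_neg, trace_neg, Complex.neg_re] at h0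
  have h1 := hGP.mul_eq_zero_of_re_trace hA.1
    (le_antisymm (by linarith) (hGP.re_trace_mul_nonneg hA.1))
  rw [hG, Matrix.sub_mul, Matrix.smul_mul, Matrix.smul_mul, Matrix.one_mul] at h1
  exact sub_eq_zero.1 h1

/-- A block maximizer only uses the directions that are visible through the channel. -/
theorem exists_eq_mul_mul (hσ : 0 < S.σ) (hW : 0 < S.W) (hη : 0 < S.η) (hp : 0 < S.fixedPower T)
    (hH : ∀ i, S.activeH T i ≠ 0) (hQ : Q ∈ feasibleCov K N) (hA : S.IsBlockMaximizer T i Q A) :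
    ∃ Y : Matrix T T ℂ, A = S.activeH T i * Y * (S.activeH T i)ᴴ := by
  have hP := update_mem_feasibleCov hQ i hA.1
  have h := hA.smul_eq_blockGrad_mul hW hη hp hQ
  have hpos := div_pos (hA.ee_pos hσ hW hη hp hH hQ) hη
  set P := Function.update Q i A
  set l := S.ee T P / S.η
  have h1 : A = (l⁻¹ * S.natBandwidth) • (S.blockGrad T P i * A) := by
    rw [mul_smul, ← h, smul_smul, inv_mul_cancel₀ hpos.ne', one_smul]
  have h2 : A = (l⁻¹ * S.natBandwidth) • (A * S.blockGrad T P i) := by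
    have := congrArg conjTranspose h1
    rwa [conjTranspose_smul, star_trivial, conjTranspose_mul, hA.1.1.eq,
      (blockGrad_isHermitian hP i).eq] at this
  -- Using the stationarity equation and its adjoint puts A between two gradients, hence between H
  -- and Hᴴ.
  have h3 : A = (l⁻¹ * S.natBandwidth) • (S.blockGrad T P i *
      ((l⁻¹ * S.natBandwidth) • (A * S.blockGrad T P i))) := by
    rw [← h2, ← h1]
  set μ := l⁻¹ * S.natBandwidth * (1 / S.σ ^ 2) with hμ
  refine ⟨(μ * μ) • ((S.macMatrix T P)⁻¹ * (S.activeH T i)ᴴ * A * S.activeH T i *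
    (S.macMatrix T P)⁻¹), ?_⟩
  refine h3.trans ?_
  simp only [blockGrad, Matrix.smul_mul, Matrix.mul_smul, smul_smul, Matrix.mul_assoc, hμ]
  congr 1
  ring

end IsBlockMaximizer

/-- X ↦ HᴴXH is injective on matrices of the form H Y Hᴴ, hence bounded below in finite dimension.
-/
theorem exists_norm_mul_mul_le {n m : Type*} [Fintype n] [DecidableEq n] [Fintype m]
    [DecidableEq m] (H : Matrix n m ℂ) :
    ∃ C : ℝ, 0 ≤ C ∧ ∀ Y : Matrix m m ℂ, ‖H * Y * Hᴴ‖ ≤ C * ‖Hᴴ * (H * Y * Hᴴ) * H‖ := by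
  let f : Matrix m m ℂ →ₗ[ℂ] Matrix n n ℂ :=
    { toFun := fun Y => H * Y * Hᴴ
      map_add' := fun A B => by rw [Matrix.mul_add, Matrix.add_mul]
      map_smul' := fun c A => by rw [Matrix.mul_smul, Matrix.smul_mul]; rfl }
  let g : f.range →ₗ[ℂ] Matrix m m ℂ :=
    { toFun := fun X => Hᴴ * X.1 * H
      map_add' := fun A B => by
        rw [Submodule.coe_add, Matrix.mul_add, Matrix.add_mul]
      map_smul' := fun c A => by
        rw [Submodule.coe_smul, Matrix.mul_smul, Matrix.smul_mul]; rfl }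
  have hg : g.ker = ⊥ := by
    rw [LinearMap.ker_eq_bot']
    rintro ⟨_, Y, rfl⟩ h
    have h1 : Hᴴ * (H * Y * Hᴴ) * H = 0 := h
    have h2 : Hᴴ * H * (Y * Hᴴ * H) = 0 := by
      simpa only [Matrix.mul_assoc] using h1
    rw [conjTranspose_mul_self_mul_eq_zero] at h2
    have h3 : H * Y * (Hᴴ * H) = 0 := by
      simpa only [Matrix.mul_assoc] using h2
    rw [mul_conjTranspose_mul_self_eq_zero] at h3
    exact Subtype.ext h3
  obtain ⟨C, -, hC⟩ := g.exists_antilipschitzWith hg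
  refine ⟨C, C.2, fun Y => ?_⟩
  have := hC.le_mul_norm (map_zero g) ⟨f Y, Y, rfl⟩
  exact this

end MIMOBC

end BlockMaximizers

/-! ### Uniqueness, sufficient increase and convergence of the sweeps. -/

section Convergence

open scoped Matrix.Norms.L2Operator MatrixOrder
open Matrix

namespace MIMOBC

variable {K N M : ℕ} {S : MIMOBC K N M} {T : Finset (Fin M)}

theorem sq_norm_linPart_le {P Q : CovTuple K N} (hP : P ∈ feasibleCov K N) :
    ‖S.linPart T (Q - P)‖ ^ 2 ≤
      2 * ‖S.macMatrix T P‖ ^ 2 * (‖S.macMatrix T Q‖ + 1) * S.remainder T P Q := by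
  cases isEmpty_or_nonempty T
  · rw [Subsingleton.elim (S.linPart T (Q - P)) 0]
    have := remainder_nonneg (S := S) (T := T) P Q
    simp only [norm_zero, ne_eq, OfNat.ofNat_ne_zero, not_false_eq_true, zero_pow]
    exact mul_nonneg (mul_nonneg (mul_nonneg two_pos.le (sq_nonneg _))
      (add_nonneg (norm_nonneg _) one_pos.le)) this
  · have h4 := norm_macMatrix_pos (S := S) (T := T) hP
    rw [remainder, mul_div_cancel₀]
    exact (mul_pos (mul_pos two_pos (pow_pos h4 2))
      (add_pos_of_nonneg_of_pos (norm_nonneg _) one_pos)).ne'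

theorem norm_le_mul_norm_linPart_single (hσ : 0 < S.σ) :
    ∃ C : ℝ, 0 ≤ C ∧ ∀ (i : Fin K) (Y : Matrix T T ℂ),
      ‖S.activeH T i * Y * (S.activeH T i)ᴴ‖ ≤
        C * ‖S.linPart T (Pi.single i (S.activeH T i * Y * (S.activeH T i)ᴴ))‖ := by
  choose C hC h using fun i => exists_norm_mul_mul_le (S.activeH T i)
  refine ⟨(∑ i, C i) * S.σ ^ 2, mul_nonneg (Finset.sum_nonneg fun i _ => hC i) (sq_nonneg _),
    fun i Y => (h i Y).trans ?_⟩
  rw [linPart_single, Complex.coe_smul, norm_smul, Real.norm_of_nonneg (by positivity)]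
  have h1 : C i ≤ ∑ i, C i := Finset.single_le_sum (fun j _ => hC j) (Finset.mem_univ i)
  have h2 : ∀ x : ℝ, (∑ i, C i) * S.σ ^ 2 * (1 / S.σ ^ 2 * x) = (∑ i, C i) * x := fun x => by
    field_simp
  rw [h2]
  gcongr

/-- At a block maximizer the linear term is nonpositive, so the remainder alone is left below the
loss in `ee`. Uniqueness and sufficient increase both rest on this. -/
theorem mul_remainder_le_of_isBlockMaximizer (hW : 0 < S.W) (hη : 0 < S.η)
    (hp : 0 < S.fixedPower T) {Q : CovTuple K N} {i : Fin K} {A B : Matrix (Fin N) (Fin N) ℂ}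
    (hQ : Q ∈ feasibleCov K N) (hA : S.IsBlockMaximizer T i Q A) (hB : B.PosSemidef) :
    S.natBandwidth * S.remainder T (Function.update Q i A) (Function.update Q i B) ≤
      S.totalPower T (Function.update Q i B) *
        (S.ee T (Function.update Q i A) - S.ee T (Function.update Q i B)) := by
  have h1 := totalPower_mul_ee_sub_le (S := S) (T := T) hW hη hp (update_mem_feasibleCov hQ i hA.1)
    (update_mem_feasibleCov hQ i hB)
  have h2 := hA.dirDeriv_le hW hη hp hQ hB
  rw [update_sub_update, traceSum_single] at h1
  linarith

theorem exists_isBlockMaximizer (hσ : 0 < S.σ) (hW : 0 < S.W) (hη : 0 < S.η)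
    (hp : 0 < S.fixedPower T) (hH : ∀ i, S.activeH T i ≠ 0) {Q : CovTuple K N}
    (hQ : Q ∈ feasibleCov K N) (i : Fin K) : ∃ A, S.IsBlockMaximizer T i Q A := by
  have hcl : IsClosed (feasibleCov K N ∩ ⋂ j : {j // j ≠ i}, {Q' : CovTuple K N | Q' j = Q j}) :=
    isClosed_feasibleCov.inter (isClosed_iInter fun j =>
      isClosed_eq (continuous_apply _) continuous_const)
  have hmem : ∀ A : Matrix (Fin N) (Fin N) ℂ, A.PosSemidef → Function.update Q i A ∈
      feasibleCov K N ∩ ⋂ j : {j // j ≠ i}, {Q' : CovTuple K N | Q' j = Q j} := fun A hA =>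
    ⟨update_mem_feasibleCov hQ i hA, Set.mem_iInter.2 fun j => by simp [j.2]⟩
  obtain ⟨Q', hQ', hmax⟩ := exists_isMaxOn_of_isClosed hW hη hp hcl Set.inter_subset_left
    (hmem 1 PosSemidef.one) (MIMOBC.ee_pos hW hη hp (update_mem_feasibleCov hQ i PosSemidef.one)
      (linPart_update_one_ne_zero hσ hH hQ i))
  have hQ'eq : Function.update Q i (Q' i) = Q' := by
    ext1 j
    rcases eq_or_ne j i with rfl | hj
    · simp
    · have := Set.mem_iInter.1 hQ'.2 ⟨j, hj⟩
      simp only [ne_eq, hj, not_false_eq_true, Function.update_of_ne]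
      exact this.symm
  exact ⟨Q' i, hQ'.1 i, fun B hB => by
    rw [hQ'eq]
    exact hmax _ (hmem B hB)⟩

/-- Equal values force a zero remainder, so B - A is invisible through the channel; being of the
form H Y Hᴴ, it is zero. -/
theorem IsBlockMaximizer.unique (hσ : 0 < S.σ) (hW : 0 < S.W) (hη : 0 < S.η)
    (hp : 0 < S.fixedPower T) (hH : ∀ i, S.activeH T i ≠ 0) {Q : CovTuple K N}
    (hQ : Q ∈ feasibleCov K N) {i : Fin K} {A B : Matrix (Fin N) (Fin N) ℂ}
    (hA : S.IsBlockMaximizer T i Q A) (hB : S.IsBlockMaximizer T i Q B) : A = B := by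
  have h1 := mul_remainder_le_of_isBlockMaximizer hW hη hp hQ hA hB.1
  rw [le_antisymm (hA.2 B hB.1) (hB.2 A hA.1), sub_self, mul_zero] at h1
  have h2 : S.remainder T (Function.update Q i A) (Function.update Q i B) = 0 := by
    refine le_antisymm ?_ (remainder_nonneg _ _)
    by_contra! h
    exact absurd h1 (not_le.2 (mul_pos (S.natBandwidth_pos hW) h))
  have h3 := sq_norm_linPart_le (S := S) (T := T) (Q := Function.update Q i B)
    (update_mem_feasibleCov hQ i hA.1)
  rw [h2, mul_zero, update_sub_update] at h3
  have h4 : ‖S.linPart T (Pi.single i (B - A))‖ = 0 :=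
    (pow_eq_zero_iff two_ne_zero).1 (le_antisymm h3 (sq_nonneg _))
  obtain ⟨Y, hY⟩ := hA.exists_eq_mul_mul hσ hW hη hp hH hQ
  obtain ⟨Z, hZ⟩ := hB.exists_eq_mul_mul hσ hW hη hp hH hQ
  have h5 : B - A = S.activeH T i * (Z - Y) * (S.activeH T i)ᴴ := by
    rw [Matrix.mul_sub, Matrix.sub_mul, ← hY, ← hZ]
  obtain ⟨C, -, hC⟩ := norm_le_mul_norm_linPart_single (S := S) (T := T) hσ
  have h6 := hC i (Z - Y)
  rw [← h5, h4, mul_zero] at h6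
  exact (sub_eq_zero.1 (norm_le_zero_iff.1 h6)).symm

theorem exists_bounds_of_le_ee (hW : 0 < S.W) (hη : 0 < S.η) (hp : 0 < S.fixedPower T)
    {α : ℝ} (hα : 0 < α) :
    ∃ R : ℝ, 0 < R ∧ ∀ Q ∈ feasibleCov K N, α ≤ S.ee T Q →
      traceSum K N Q ≤ R ∧ ‖S.macMatrix T Q‖ ≤ R ∧ S.totalPower T Q ≤ R := by
  obtain ⟨R, hR, h⟩ := exists_traceSum_le_of_le_ee (S := S) (T := T) hW hη hp hα
  obtain ⟨l, hl, hL⟩ := S.exists_norm_linPart_le T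
  refine ⟨R + (‖(1 : Matrix T T ℂ)‖ + l * R) + (R / S.η + S.fixedPower T), by positivity,
    fun Q hQ hle => ?_⟩
  have h1 := h Q hQ hle
  have h2 : ‖S.macMatrix T Q‖ ≤ ‖(1 : Matrix T T ℂ)‖ + l * R := by
    rw [macMatrix_eq]
    refine (norm_add_le _ _).trans (add_le_add le_rfl ((hL Q).trans ?_))
    gcongr
    exact (norm_le_traceSum hQ).trans h1
  have h3 : S.totalPower T Q ≤ R / S.η + S.fixedPower T := by
    rw [totalPower_eq]
    gcongr
  have h4 : 0 ≤ ‖(1 : Matrix T T ℂ)‖ + l * R := by positivity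
  have h5 : 0 ≤ R / S.η + S.fixedPower T := by positivity
  exact ⟨by linarith, by linarith, by linarith⟩

/-- Sufficient increase of the energy efficiency in a single block update. -/
theorem exists_sq_norm_sub_le (hσ : 0 < S.σ) (hW : 0 < S.W) (hη : 0 < S.η)
    (hp : 0 < S.fixedPower T) (hH : ∀ i, S.activeH T i ≠ 0) {α : ℝ} (hα : 0 < α) :
    ∃ B : ℝ, 0 ≤ B ∧ ∀ Q ∈ feasibleCov K N, α ≤ S.ee T Q → ∀ (i : Fin K)
      (A : Matrix (Fin N) (Fin N) ℂ), S.IsBlockMaximizer T i Q A →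
      (∃ Y : Matrix T T ℂ, Q i = S.activeH T i * Y * (S.activeH T i)ᴴ) →
      ‖A - Q i‖ ^ 2 ≤ B * (S.ee T (Function.update Q i A) - S.ee T Q) := by
  obtain ⟨R, hR, hbd⟩ := exists_bounds_of_le_ee (S := S) (T := T) hW hη hp hα
  obtain ⟨C, hC0, hC⟩ := norm_le_mul_norm_linPart_single (S := S) (T := T) hσ
  have hκ := S.natBandwidth_pos hW
  refine ⟨C ^ 2 * (2 * R ^ 2 * (R + 1)) * (R / S.natBandwidth), by positivity,
    fun Q hQ hle i A hA ⟨Y, hY⟩ => ?_⟩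
  have hinc : S.ee T Q ≤ S.ee T (Function.update Q i A) := by
    have := hA.2 (Q i) (hQ i)
    rwa [Function.update_eq_self] at this
  have hP := update_mem_feasibleCov hQ i hA.1
  have h1 := mul_remainder_le_of_isBlockMaximizer hW hη hp hQ hA (hQ i)
  have h2 := sq_norm_linPart_le (S := S) (T := T) (Q := Function.update Q i (Q i)) hP
  rw [update_sub_update, Function.update_eq_self] at h2
  rw [Function.update_eq_self] at h1
  obtain ⟨-, hm, hpw⟩ := hbd Q hQ hle
  obtain ⟨-, hm', -⟩ := hbd _ hP (hle.trans hinc)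
  obtain ⟨Z, hZ⟩ := hA.exists_eq_mul_mul hσ hW hη hp hH hQ
  have h5 : Q i - A = S.activeH T i * (Y - Z) * (S.activeH T i)ᴴ := by
    -- The old block must also have the visible form: otherwise the step could contain directions
    -- that leave `ee`'s rate unchanged and escape the remainder.
    rw [Matrix.mul_sub, Matrix.sub_mul, ← hY, ← hZ]
  have h6 := hC i (Y - Z)
  rw [← h5] at h6
  have hrem := remainder_nonneg (S := S) (T := T) (Function.update Q i A) Q
  have h7 : S.remainder T (Function.update Q i A) Q ≤
      R / S.natBandwidth * (S.ee T (Function.update Q i A) - S.ee T Q) := by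
    rw [div_mul_eq_mul_div, le_div_iff₀ hκ, mul_comm]
    exact h1.trans (mul_le_mul_of_nonneg_right hpw (sub_nonneg.2 hinc))
  calc ‖A - Q i‖ ^ 2 = ‖Q i - A‖ ^ 2 := by rw [norm_sub_rev]
    _ ≤ (C * ‖S.linPart T (Pi.single i (Q i - A))‖) ^ 2 := by gcongr
    _ = C ^ 2 * ‖S.linPart T (Pi.single i (Q i - A))‖ ^ 2 := mul_pow _ _ _
    _ ≤ C ^ 2 * (2 * R ^ 2 * (R + 1) * S.remainder T (Function.update Q i A) Q) := by
        refine mul_le_mul_of_nonneg_left (h2.trans (mul_le_mul_of_nonneg_right ?_ hrem))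
          (sq_nonneg C)
        have hx := norm_nonneg (S.macMatrix T (Function.update Q i A))
        have hy := norm_nonneg (S.macMatrix T Q)
        generalize ‖S.macMatrix T (Function.update Q i A)‖ = x at *
        generalize ‖S.macMatrix T Q‖ = y at *
        gcongr
    _ ≤ C ^ 2 * (2 * R ^ 2 * (R + 1) * (R / S.natBandwidth *
          (S.ee T (Function.update Q i A) - S.ee T Q))) := by gcongr
    _ = _ := by ring

/-- A one-sided Lipschitz bound read off the tangent inequality; exchanging P and Q gives the other
side. -/
theorem exists_ee_sub_le (hW : 0 < S.W) (hη : 0 < S.η) (hp : 0 < S.fixedPower T) (l : ℝ) :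
    ∃ C : ℝ, 0 ≤ C ∧ ∀ P ∈ feasibleCov K N, ∀ Q ∈ feasibleCov K N, S.ee T P ≤ l →
      S.ee T Q - S.ee T P ≤ C * ‖Q - P‖ := by
  obtain ⟨a, ha, hD⟩ := S.exists_abs_dirDeriv_le T
  obtain ⟨b, hb, hL⟩ := S.exists_norm_linPart_le T
  obtain ⟨t, ht, hT⟩ := exists_abs_traceSum_le K N
  have hκ := S.natBandwidth_pos hW
  refine ⟨(S.natBandwidth * (a * b) + |l| / S.η * t) / S.fixedPower T, by positivity,
    fun P hP Q hQ hl => ?_⟩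
  rcases le_total (S.ee T Q) (S.ee T P) with hle | hle
  · exact (sub_nonpos.2 hle).trans (by positivity)
  rw [div_mul_eq_mul_div, le_div_iff₀ hp]
  have h1 := totalPower_mul_ee_sub_le (S := S) (T := T) hW hη hp hP hQ
  have h2 := mul_nonneg hκ.le (remainder_nonneg (S := S) (T := T) P Q)
  have h3 : (S.ee T Q - S.ee T P) * S.fixedPower T ≤
      S.totalPower T Q * (S.ee T Q - S.ee T P) := by
    rw [mul_comm]
    exact mul_le_mul_of_nonneg_right (fixedPower_le_totalPower hη hQ) (sub_nonneg.2 hle)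
  have h4 : S.natBandwidth * S.dirDeriv T P (Q - P) ≤
      S.natBandwidth * (a * (b * ‖Q - P‖)) := by
    gcongr
    refine (le_abs_self _).trans ((hD P hP _).trans ?_)
    gcongr
    exact hL _
  have h5 : -(S.ee T P / S.η * traceSum K N (Q - P)) ≤ |l| / S.η * (t * ‖Q - P‖) := by
    have h6 := ee_nonneg (S := S) (T := T) hW hη hp hP
    rw [← mul_neg]
    calc S.ee T P / S.η * -traceSum K N (Q - P) ≤ S.ee T P / S.η * (t * ‖Q - P‖) := by
          gcongr
          exact (neg_le_abs _).trans (hT _)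
      _ ≤ |l| / S.η * (t * ‖Q - P‖) := by
          gcongr
          exact hl.trans (le_abs_self l)
  nlinarith

end MIMOBC

theorem midSweep_zero {K N : ℕ} (Q P : CovTuple K N) : midSweep Q P 0 = Q := by
  ext1 j
  simp [midSweep]

theorem midSweep_self {K N : ℕ} (Q P : CovTuple K N) : midSweep Q P K = P := by
  ext1 j
  simp [midSweep]

theorem midSweep_apply_self {K N : ℕ} (Q P : CovTuple K N) (i : Fin K) :
    midSweep Q P i i = Q i := by
  simp [midSweep]

theorem update_midSweep {K N : ℕ} (Q P : CovTuple K N) (i : Fin K) :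
    Function.update (midSweep Q P i) i (P i) = midSweep Q P (i + 1) := by
  ext1 j
  rcases eq_or_ne j i with rfl | hj
  · simp [midSweep]
  · have h : (j : ℕ) ≠ i := fun h => hj (Fin.ext h)
    rw [Function.update_of_ne hj]
    have : (j : ℕ) < i ↔ (j : ℕ) < i + 1 := by omega
    simp only [midSweep, this]

theorem midSweep_mem_feasibleCov {K N : ℕ} {Q P : CovTuple K N} (hQ : Q ∈ feasibleCov K N)
    (hP : P ∈ feasibleCov K N) (m : ℕ) : midSweep Q P m ∈ feasibleCov K N := by
  intro j
  simp only [midSweep]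
  split_ifs
  exacts [hP j, hQ j]

theorem norm_sub_midSweep_le {K N : ℕ} (Q P : CovTuple K N) (m : ℕ) :
    ‖P - midSweep Q P m‖ ≤ ‖P - Q‖ := by
  refine (pi_norm_le_iff_of_nonneg (norm_nonneg _)).2 fun j => ?_
  simp only [Pi.sub_apply, midSweep]
  split_ifs
  · simp
  · exact norm_le_pi_norm (P - Q) j

theorem midSweep_congr {K N : ℕ} {Q P P' : CovTuple K N} {m : ℕ}
    (h : ∀ j : Fin K, (j : ℕ) < m → P j = P' j) : midSweep Q P m = midSweep Q P' m := by
  ext1 j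
  simp only [midSweep]
  split_ifs with hj
  exacts [h j hj, rfl]

namespace MIMOBC

variable {K N M : ℕ} {S : MIMOBC K N M} {T : Finset (Fin M)}

/-- `P` arises from `Q` by one sweep of block updates. -/
def IsSweep (S : MIMOBC K N M) (T : Finset (Fin M)) (Q P : CovTuple K N) : Prop :=
  ∀ i : Fin K, S.IsBlockMaximizer T i (midSweep Q P i) (P i)

theorem IsSweep.mem_feasibleCov {Q P : CovTuple K N} (h : S.IsSweep T Q P) :
    P ∈ feasibleCov K N := fun i => (h i).1

theorem IsSweep.ee_midSweep_le {Q P : CovTuple K N} (hQ : Q ∈ feasibleCov K N)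
    (h : S.IsSweep T Q P) (i : Fin K) :
    S.ee T (midSweep Q P i) ≤ S.ee T (midSweep Q P (i + 1)) := by
  have h1 := (h i).2 (Q i) (hQ i)
  rw [update_midSweep] at h1
  convert h1 using 2
  rw [← midSweep_apply_self Q P i, Function.update_eq_self]

theorem IsSweep.ee_midSweep_mono {Q P : CovTuple K N} (hQ : Q ∈ feasibleCov K N)
    (h : S.IsSweep T Q P) {a b : ℕ} (hab : a ≤ b) (hb : b ≤ K) :
    S.ee T (midSweep Q P a) ≤ S.ee T (midSweep Q P b) := by
  induction b, hab using Nat.le_induction with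
  | base => exact le_rfl
  | succ b _ ih => exact (ih (by omega)).trans (h.ee_midSweep_le hQ ⟨b, by omega⟩)

theorem IsSweep.ee_le {Q P : CovTuple K N} (hQ : Q ∈ feasibleCov K N)
    (h : S.IsSweep T Q P) : S.ee T Q ≤ S.ee T P := by
  have := h.ee_midSweep_mono hQ (Nat.zero_le K) le_rfl
  rwa [midSweep_zero, midSweep_self] at this

theorem exists_isSweep (hσ : 0 < S.σ) (hW : 0 < S.W) (hη : 0 < S.η)
    (hp : 0 < S.fixedPower T) (hH : ∀ i, S.activeH T i ≠ 0) {Q : CovTuple K N}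
    (hQ : Q ∈ feasibleCov K N) : ∃ P, S.IsSweep T Q P := by
  have key : ∀ m ≤ K, ∃ P ∈ feasibleCov K N, ∀ i : Fin K, (i : ℕ) < m →
      S.IsBlockMaximizer T i (midSweep Q P i) (P i) := by
    intro m
    induction m with
    | zero => exact fun _ => ⟨Q, hQ, fun i hi => absurd hi (Nat.not_lt_zero _)⟩
    | succ m ih =>
      intro hm
      obtain ⟨P, hP, h⟩ := ih (by omega)
      set i₀ : Fin K := ⟨m, hm⟩
      obtain ⟨A, hA⟩ := exists_isBlockMaximizer hσ hW hη hp hH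
        (midSweep_mem_feasibleCov hQ hP m) i₀
      refine ⟨Function.update P i₀ A, update_mem_feasibleCov hP i₀ hA.1, fun i hi => ?_⟩
      -- For i ≤ m the state before updating user i reads only new entries of index below m, so
      -- setting entry m does not disturb it.
      have hmid : midSweep Q (Function.update P i₀ A) i = midSweep Q P i := by
        refine midSweep_congr fun j hj => Function.update_of_ne ?_ _ _
        intro h
        rw [h] at hj
        change m < (i : ℕ) at hj
        omega
      rw [hmid]
      rcases eq_or_ne i i₀ with rfl | hne
      · simpa using hA
      · rw [Function.update_of_ne hne]
        refine h i ?_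
        have : (i : ℕ) ≠ m := fun h => hne (Fin.ext h)
        omega
  obtain ⟨P, -, h⟩ := key K le_rfl
  exact ⟨P, fun i => h i i.2⟩

theorem IsSweep.unique (hσ : 0 < S.σ) (hW : 0 < S.W) (hη : 0 < S.η)
    (hp : 0 < S.fixedPower T) (hH : ∀ i, S.activeH T i ≠ 0) {Q P P' : CovTuple K N}
    (hQ : Q ∈ feasibleCov K N) (h : S.IsSweep T Q P) (h' : S.IsSweep T Q P') : P = P' := by
  have key : ∀ m : ℕ, ∀ i : Fin K, (i : ℕ) = m → P i = P' i := by
    intro m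
    induction m using Nat.strong_induction_on with
    | _ m ih =>
      intro i hi
      have h1 := h i
      rw [midSweep_congr fun j hj => ih j (hi ▸ hj) j rfl] at h1
      exact h1.unique hσ hW hη hp hH (midSweep_mem_feasibleCov hQ h'.mem_feasibleCov _) (h' i)
  ext1 i
  exact key i i rfl

/-- The optimality gap after a sweep is bounded by the length of the sweep times the distance to
the solution set. -/
theorem exists_gap_le (hW : 0 < S.W) (hη : 0 < S.η) (hp : 0 < S.fixedPower T) {l : ℝ}
    (hl : ∀ Q ∈ feasibleCov K N, S.ee T Q ≤ l) :
    ∃ C : ℝ, 0 ≤ C ∧ ∀ Q ∈ feasibleCov K N, ∀ P, S.IsSweep T Q P →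
      ∀ Z ∈ feasibleCov K N, S.ee T Z = l → l - S.ee T P ≤ C * ‖P - Q‖ * ‖P - Z‖ := by
  obtain ⟨a, ha, hD⟩ := abs_dirDeriv_sub_le S T
  obtain ⟨e, he, hE⟩ := exists_ee_sub_le (S := S) (T := T) hW hη hp l
  obtain ⟨t, ht, hT⟩ := exists_abs_re_trace_le (Fin N)
  have hκ := S.natBandwidth_pos hW
  refine ⟨K * (S.natBandwidth * a + e / S.η * t) / S.fixedPower T, by positivity,
    fun Q hQ P hQP Z hZ hZl => ?_⟩
  have hP := hQP.mem_feasibleCov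
  have h1 := totalPower_mul_ee_sub_le (S := S) (T := T) hW hη hp hP hZ
  rw [dirDeriv_eq_sum, traceSum_apply, Finset.mul_sum, Finset.mul_sum,
    ← Finset.sum_sub_distrib, hZl] at h1
  have hgap : 0 ≤ l - S.ee T P := sub_nonneg.2 (hl P hP)
  have h2 := mul_nonneg hκ.le (remainder_nonneg (S := S) (T := T) P Z)
  -- The tangent inequality at P splits over users, but the optimality of block i holds at the
  -- mid-sweep state X. Moving gradient and ratio from X to P costs O(‖P - Q‖).
  have hterm : ∀ i ∈ Finset.univ, S.natBandwidth * S.dirDeriv T P (Pi.single i ((Z - P) i)) -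
      S.ee T P / S.η * ((Z - P) i).trace.re ≤
        (S.natBandwidth * a + e / S.η * t) * (‖P - Q‖ * ‖P - Z‖) := fun i _ => by
    set X := midSweep Q P (i + 1) with hX
    have hXf : X ∈ feasibleCov K N := midSweep_mem_feasibleCov hQ hP _
    have hPX : ‖P - X‖ ≤ ‖P - Q‖ := norm_sub_midSweep_le Q P _
    have h3 := (hQP i).dirDeriv_le hW hη hp (midSweep_mem_feasibleCov hQ hP _) (hZ i)
    rw [update_midSweep, ← hX] at h3
    change S.natBandwidth * S.dirDeriv T X (Pi.single i ((Z - P) i)) ≤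
      S.ee T X / S.η * ((Z - P) i).trace.re at h3
    have hni : ‖(Z - P) i‖ ≤ ‖P - Z‖ := by
      rw [norm_sub_rev]
      exact norm_le_pi_norm (Z - P) i
    have hsing : ‖(Pi.single i ((Z - P) i) : CovTuple K N)‖ ≤ ‖P - Z‖ := by
      rw [Pi.norm_single]
      exact hni
    have h4 : S.natBandwidth * (S.dirDeriv T P (Pi.single i ((Z - P) i)) -
        S.dirDeriv T X (Pi.single i ((Z - P) i))) ≤
        S.natBandwidth * (a * ‖P - Q‖ * ‖P - Z‖) := by
      refine mul_le_mul_of_nonneg_left ((le_abs_self _).trans ((hD P hP X hXf _).trans ?_)) hκ.le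
      exact mul_le_mul (mul_le_mul_of_nonneg_left hPX ha) hsing (norm_nonneg _)
        (mul_nonneg ha (norm_nonneg _))
    have h5 : (S.ee T X - S.ee T P) / S.η * ((Z - P) i).trace.re ≤
        e * ‖P - Q‖ / S.η * (t * ‖P - Z‖) := by
      refine (le_abs_self _).trans ?_
      rw [abs_mul]
      have h6 : |(S.ee T X - S.ee T P) / S.η| ≤ e * ‖P - Q‖ / S.η := by
        rw [abs_div, abs_of_pos hη]
        gcongr
        rw [abs_le]
        constructor
        · have h7 := hE X hXf P hP (hl X hXf)
          have h8 : e * ‖P - X‖ ≤ e * ‖P - Q‖ := by gcongr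
          linarith
        · have h7 := hE P hP X hXf (hl P hP)
          have h8 : e * ‖X - P‖ ≤ e * ‖P - Q‖ := by
            rw [norm_sub_rev]
            gcongr
          linarith
      exact mul_le_mul h6 ((hT _).trans (mul_le_mul_of_nonneg_left hni ht)) (abs_nonneg _)
        ((abs_nonneg _).trans h6)
    have h9 : (S.ee T X - S.ee T P) / S.η * ((Z - P) i).trace.re =
        S.ee T X / S.η * ((Z - P) i).trace.re - S.ee T P / S.η * ((Z - P) i).trace.re := by ring
    have h10 : (S.natBandwidth * a + e / S.η * t) * (‖P - Q‖ * ‖P - Z‖) =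
        S.natBandwidth * (a * ‖P - Q‖ * ‖P - Z‖) + e * ‖P - Q‖ / S.η * (t * ‖P - Z‖) := by ring
    rw [h10]
    linarith
  have h3 := Finset.sum_le_sum hterm
  rw [Finset.sum_const, Finset.card_univ, Fintype.card_fin, nsmul_eq_mul] at h3
  have h4 := mul_le_mul_of_nonneg_right (fixedPower_le_totalPower (T := T) hη hZ) hgap
  rw [div_mul_eq_mul_div, div_mul_eq_mul_div, le_div_iff₀ hp]
  linarith

/-- Encodes a tuple as one matrix, to which the error bound applies. -/
theorem blockDiagonal_posSemidef {Q : CovTuple K N} (hQ : Q ∈ feasibleCov K N) :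
    (blockDiagonal Q).PosSemidef := by
  choose B hB using fun i => (hQ i).exists_eq_conjTranspose_mul_self
  have h : blockDiagonal Q = (blockDiagonal B)ᴴ * blockDiagonal B := by
    rw [blockDiagonal_conjTranspose, ← blockDiagonal_mul]
    congr 1
    ext1 i
    exact hB i
  rw [h]
  exact posSemidef_conjTranspose_mul_self _

/-- Hölder error bound for the set of global maximizers of the energy efficiency. -/
theorem exists_error_bound (hW : 0 < S.W) (hη : 0 < S.η) (hp : 0 < S.fixedPower T)
    {Q₀ : CovTuple K N} (hQ₀ : Q₀ ∈ feasibleCov K N)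
    (hmax : ∀ Q ∈ feasibleCov K N, S.ee T Q ≤ S.ee T Q₀) {α : ℝ} (hα : 0 < α) :
    ∃ C γ : ℝ, 0 ≤ C ∧ 0 < γ ∧ γ ≤ 1 ∧ ∀ Q ∈ feasibleCov K N, α ≤ S.ee T Q →
      ∃ Z ∈ feasibleCov K N, S.ee T Z = S.ee T Q₀ ∧
        ‖Q - Z‖ ≤ C * (S.ee T Q₀ - S.ee T Q) ^ γ := by
  obtain ⟨R, hR, hbd⟩ := exists_bounds_of_le_ee (S := S) (T := T) hW hη hp hα
  let bd : Matrix (Fin N × Fin K) (Fin N × Fin K) ℂ →ₗ[ℝ] CovTuple K N :=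
    { toFun := fun X => blockDiag X
      map_add' := fun X Y => blockDiag_add X Y
      map_smul' := fun c X => blockDiag_smul c X }
  have hbdQ : ∀ Q : CovTuple K N, bd (blockDiagonal Q) = Q := blockDiag_blockDiagonal
  -- `ee` depends on the tuple only through these two linear quantities, so every feasible solution
  -- of the system is a maximizer.
  let L := ((S.linPart T).prod (traceSum K N)) ∘ₗ bd
  obtain ⟨C, γ, hC, hγ, hγ1, hmain⟩ := exists_holder_error_bound (Fin N × Fin K) L
    (blockDiagonal_posSemidef hQ₀) R
  obtain ⟨b, hb, hB⟩ : ∃ b : ℝ, 0 ≤ b ∧ ∀ X, ‖bd X‖ ≤ b * ‖X‖ :=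
    ⟨‖LinearMap.toContinuousLinearMap bd‖, norm_nonneg _,
      (LinearMap.toContinuousLinearMap bd).le_opNorm⟩
  obtain ⟨a, ha, hD⟩ := S.exists_abs_dirDeriv_le T
  have hκ := S.natBandwidth_pos hW
  set l := S.ee T Q₀ with hl
  have hl0 : 0 ≤ l := ee_nonneg hW hη hp hQ₀
  obtain ⟨E, hE0, hE⟩ : ∃ E : ℝ, 0 ≤ E ∧ ∀ Q ∈ feasibleCov K N, α ≤ S.ee T Q →
      ‖L (blockDiagonal Q) - L (blockDiagonal Q₀)‖ ≤ E * √(l - S.ee T Q) := by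
    set G := √(2 * ‖S.macMatrix T Q₀‖ ^ 2 * (R + 1) * (R / S.natBandwidth)) with hG
    have hG0 : 0 ≤ G := Real.sqrt_nonneg _
    refine ⟨G + (R * √l + S.natBandwidth * (a * G)) * (S.η / l), by positivity,
      fun Q hQ hle => ?_⟩
    have hlpos : 0 < l := hα.trans_le (hle.trans (hmax Q hQ))
    set r := l - S.ee T Q with hr
    have hr0 : 0 ≤ r := sub_nonneg.2 (hmax Q hQ)
    have hrl : r ≤ l := by linarith
    obtain ⟨-, hm, hpw⟩ := hbd Q hQ hle
    have h1 := totalPower_mul_ee_sub_le (S := S) (T := T) hW hη hp hQ₀ hQ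
    have h2 := dirDeriv_le_of_forall_ee_le (S := S) (T := T) hW hη hp hQ₀ hQ fun t h0 h1 =>
      hmax _ (convex_feasibleCov.add_smul_sub_mem hQ₀ hQ ⟨h0.le, h1⟩)
    rw [← hl] at h1 h2
    have hPr : S.totalPower T Q * r ≤ R * r := mul_le_mul_of_nonneg_right hpw hr0
    have hPr' : S.totalPower T Q * (S.ee T Q - l) = -(S.totalPower T Q * r) := by
      rw [hr]; ring
    rw [hPr'] at h1
    have hrem := remainder_nonneg (S := S) (T := T) Q₀ Q
    have h3 : S.remainder T Q₀ Q ≤ R / S.natBandwidth * r := by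
      rw [div_mul_eq_mul_div, le_div_iff₀ hκ]
      linarith
    have h4 : ‖S.linPart T (Q - Q₀)‖ ≤ G * √r := by
      rw [hG, ← Real.sqrt_mul (by positivity)]
      refine Real.le_sqrt_of_sq_le ((sq_norm_linPart_le hQ₀).trans ?_)
      calc _ ≤ 2 * ‖S.macMatrix T Q₀‖ ^ 2 * (R + 1) * (R / S.natBandwidth * r) := by gcongr
        _ = _ := by ring
    have h5 : S.natBandwidth * |S.dirDeriv T Q₀ (Q - Q₀)| ≤ S.natBandwidth * (a * (G * √r)) := by
      gcongr
      exact (hD Q₀ hQ₀ _).trans (by gcongr)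
    have h6 : R * r ≤ R * (√l * √r) := by
      gcongr
      calc r = √r * √r := (Real.mul_self_sqrt hr0).symm
        _ ≤ √l * √r := by gcongr
    -- First-order optimality and the tangent inequality trap the weighted trace difference between
    -- the rate derivative and that derivative plus R r; the derivative is O(√r) by the bound on
    -- `linPart`.
    have h7 : l / S.η * |traceSum K N (Q - Q₀)| ≤
        (R * √l + S.natBandwidth * (a * G)) * √r := by
      have h8 : |l / S.η * traceSum K N (Q - Q₀)| ≤
          (R * √l + S.natBandwidth * (a * G)) * √r := by
        have h9 := mul_nonneg hκ.le hrem
        have h10 := mul_le_mul_of_nonneg_left (le_abs_self (S.dirDeriv T Q₀ (Q - Q₀))) hκ.le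
        have h11 := mul_le_mul_of_nonneg_left (neg_abs_le (S.dirDeriv T Q₀ (Q - Q₀))) hκ.le
        have h12 : 0 ≤ R * (√l * √r) := by positivity
        rw [abs_le]
        constructor <;> nlinarith
      rwa [abs_mul, abs_of_nonneg (by positivity)] at h8
    have h8 : |traceSum K N (Q - Q₀)| ≤
        (R * √l + S.natBandwidth * (a * G)) * (S.η / l) * √r := by
      have h9 : |traceSum K N (Q - Q₀)| =
          (l / S.η * |traceSum K N (Q - Q₀)|) * (S.η / l) := by field_simp
      rw [h9]
      calc _ ≤ (R * √l + S.natBandwidth * (a * G)) * √r * (S.η / l) := by gcongr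
        _ = _ := by ring
    have h9 : L (blockDiagonal Q) - L (blockDiagonal Q₀) =
        (S.linPart T (Q - Q₀), traceSum K N (Q - Q₀)) := by
      rw [← map_sub]
      change (S.linPart T (bd _), traceSum K N (bd _)) = _
      rw [map_sub, hbdQ, hbdQ]
    rw [h9]
    refine (norm_prod_le_iff).2 ⟨h4.trans ?_, ?_⟩
    · refine mul_le_mul_of_nonneg_right (le_add_of_nonneg_right ?_) (Real.sqrt_nonneg _)
      exact mul_nonneg (add_nonneg (mul_nonneg hR.le (Real.sqrt_nonneg _))
        (mul_nonneg hκ.le (mul_nonneg ha hG0))) (div_nonneg hη.le hl0)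
    · rw [Real.norm_eq_abs]
      exact h8.trans (mul_le_mul_of_nonneg_right (le_add_of_nonneg_left hG0) (Real.sqrt_nonneg _))
  -- The exponent is halved because the residual is of the order of the square root of the gap.
  refine ⟨b * (C * E ^ γ), γ / 2, by positivity, by positivity, by linarith,
    fun Q hQ hle => ?_⟩
  have hr0 : 0 ≤ l - S.ee T Q := sub_nonneg.2 (hmax Q hQ)
  have htr : ‖blockDiagonal Q‖ ≤ R := by
    refine (blockDiagonal_posSemidef hQ).norm_le_re_trace.trans ?_
    rw [trace_blockDiagonal, Complex.re_sum]
    exact (hbd Q hQ hle).1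
  obtain ⟨X, hX, hLX, hXn⟩ := hmain _ (blockDiagonal_posSemidef hQ) htr
  -- X need not be block diagonal; its diagonal blocks are semidefinite, and `L` sees only these.
  have hZ : bd X ∈ feasibleCov K N := fun i => hX.submatrix _
  have hLX' : (S.linPart T (bd X), traceSum K N (bd X)) =
      (S.linPart T Q₀, traceSum K N Q₀) := by
    have h : L (blockDiagonal Q₀) = (S.linPart T Q₀, traceSum K N Q₀) := by
      change (S.linPart T (bd _), traceSum K N (bd _)) = _
      rw [hbdQ]
    rw [← h, ← hLX]
    rfl
  obtain ⟨hl1, hl2⟩ := Prod.mk.inj hLX'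
  refine ⟨bd X, hZ, ?_, ?_⟩
  · rw [hl, ee_eq, ee_eq, totalPower_eq, totalPower_eq, hl2, logDet, logDet, macMatrix_eq,
      macMatrix_eq, hl1]
  · have h1 : Q - bd X = bd (blockDiagonal Q - X) := by rw [map_sub, hbdQ]
    rw [h1]
    calc ‖bd (blockDiagonal Q - X)‖ ≤ b * (C * (E * √(l - S.ee T Q)) ^ γ) := by
          refine (hB _).trans ?_
          gcongr
          refine hXn.trans ?_
          gcongr
          exact hE Q hQ hle
      _ = b * (C * E ^ γ) * (l - S.ee T Q) ^ (γ / 2) := by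
          rw [Real.mul_rpow hE0 (Real.sqrt_nonneg _), Real.sqrt_eq_rpow, ← Real.rpow_mul hr0]
          have : 1 / 2 * γ = γ / 2 := by ring
          rw [this]
          ring

theorem exists_global_max (hσ : 0 < S.σ) (hW : 0 < S.W) (hη : 0 < S.η)
    (hp : 0 < S.fixedPower T) (hH : ∀ i, S.activeH T i ≠ 0) (i : Fin K) :
    ∃ Q ∈ feasibleCov K N, ∀ Q' ∈ feasibleCov K N, S.ee T Q' ≤ S.ee T Q := by
  have h0 : (0 : CovTuple K N) ∈ feasibleCov K N := fun _ => PosSemidef.zero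
  exact exists_isMaxOn_of_isClosed hW hη hp isClosed_feasibleCov subset_rfl
    (update_mem_feasibleCov h0 i PosSemidef.one)
    (MIMOBC.ee_pos hW hη hp (update_mem_feasibleCov h0 i PosSemidef.one)
      (linPart_update_one_ne_zero hσ hH h0 i))

/-- Successive sweeps converge to a global maximizer of the energy efficiency. -/
theorem exists_tendsto_of_isSweep (hσ : 0 < S.σ) (hW : 0 < S.W) (hη : 0 < S.η)
    (hp : 0 < S.fixedPower T) (hH : ∀ i, S.activeH T i ≠ 0) (i₀ : Fin K)
    {Q : ℕ → CovTuple K N} (hQ0 : Q 0 ∈ feasibleCov K N)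
    (hQ : ∀ k, S.IsSweep T (Q k) (Q (k + 1))) :
    ∃ Z ∈ feasibleCov K N, Tendsto Q atTop (𝓝 Z) ∧
      Tendsto (fun k => S.ee T (Q k)) atTop (𝓝 (S.ee T Z)) ∧
      ∀ P ∈ feasibleCov K N, S.ee T P ≤ S.ee T Z := by
  have hf : ∀ k, Q k ∈ feasibleCov K N := fun k => by
    cases k with
    | zero => exact hQ0
    | succ k => exact (hQ k).mem_feasibleCov
  have hmono : Monotone fun k => S.ee T (Q k) :=
    monotone_nat_of_le_succ fun k => (hQ k).ee_le (hf k)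
  obtain ⟨Qm, hQm, hmax⟩ := exists_global_max hσ hW hη hp hH i₀
  have hα : 0 < S.ee T (Q 1) := by
    have h1 := (hQ 0 i₀).ee_pos hσ hW hη hp hH
      (midSweep_mem_feasibleCov (hf 0) (hf 1) _)
    rw [update_midSweep] at h1
    refine h1.trans_le ?_
    have h2 := (hQ 0).ee_midSweep_mono (hf 0) (show (i₀ : ℕ) + 1 ≤ K from i₀.2) le_rfl
    rwa [midSweep_self] at h2
  obtain ⟨B, hB, hinc⟩ := exists_sq_norm_sub_le (S := S) (T := T) hσ hW hη hp hH hα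
  obtain ⟨C, hC, hgap⟩ := exists_gap_le (S := S) (T := T) hW hη hp hmax
  obtain ⟨D, γ, hD, hγ, hγ1, herr⟩ := exists_error_bound (S := S) (T := T) hW hη hp hQm hmax hα
  have hle : ∀ k, S.ee T (Q 1) ≤ S.ee T (Q (k + 1)) := fun k => hmono (by omega)
  -- The first sweep is skipped: the start may have zero `ee` and blocks not of the form H Y Hᴴ, but
  -- every later iterate has neither defect.
  set d : ℕ → ℝ := fun k => ‖Q (k + 2) - Q (k + 1)‖ with hd
  set r : ℕ → ℝ := fun k => S.ee T Qm - S.ee T (Q (k + 1)) with hr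
  have hr0 : ∀ k, 0 ≤ r k := fun k => sub_nonneg.2 (hmax _ (hf _))
  have hdec : ∀ k, d k ^ 2 ≤ B * (r k - r (k + 1)) := fun k => by
    have hrr : r k - r (k + 1) = S.ee T (Q (k + 2)) - S.ee T (Q (k + 1)) := by
      simp only [hr]
      ring
    rw [hrr]
    have hnn : 0 ≤ B * (S.ee T (Q (k + 2)) - S.ee T (Q (k + 1))) :=
      mul_nonneg hB (sub_nonneg.2 (hmono (by omega)))
    suffices h : d k ≤ √(B * (S.ee T (Q (k + 2)) - S.ee T (Q (k + 1)))) by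
      calc d k ^ 2 ≤ √(B * (S.ee T (Q (k + 2)) - S.ee T (Q (k + 1)))) ^ 2 :=
            pow_le_pow_left₀ (norm_nonneg _) h 2
        _ = _ := Real.sq_sqrt hnn
    -- In the sup norm one user suffices at a time, and the increase of one update is at most that
    -- of the whole sweep.
    refine (pi_norm_le_iff_of_nonneg (Real.sqrt_nonneg _)).2 fun i => Real.le_sqrt_of_sq_le ?_
    have hs := hQ (k + 1)
    have hm1 := hs.ee_midSweep_mono (hf _) (Nat.zero_le i) i.2.le
    have hm2 := hs.ee_midSweep_mono (hf _) (show (i : ℕ) + 1 ≤ K from i.2) le_rfl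
    rw [midSweep_zero] at hm1
    rw [midSweep_self] at hm2
    have h1 := hinc _ (midSweep_mem_feasibleCov (hf (k + 1)) (hf (k + 2)) i)
      ((hle k).trans hm1) i _ (hs i) (by
        rw [midSweep_apply_self]
        exact (hQ k i).exists_eq_mul_mul hσ hW hη hp hH
          (midSweep_mem_feasibleCov (hf k) (hf (k + 1)) i))
    rw [midSweep_apply_self, update_midSweep] at h1
    refine h1.trans (mul_le_mul_of_nonneg_left ?_ hB)
    exact sub_le_sub hm2 hm1
  have hkl : ∀ k, r (k + 1) ≤ C * D * d k * r (k + 1) ^ γ := fun k => by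
    obtain ⟨Z, hZ, hZe, hZn⟩ := herr (Q (k + 2)) (hf _) (hle (k + 1))
    have h1 := hgap _ (hf (k + 1)) _ (hQ (k + 1)) Z hZ hZe
    calc r (k + 1) ≤ C * d k * ‖Q (k + 2) - Z‖ := h1
      _ ≤ C * d k * (D * r (k + 1) ^ γ) :=
          mul_le_mul_of_nonneg_left hZn (mul_nonneg hC (norm_nonneg _))
      _ = _ := by ring
  have hsum : Summable d := by
    refine summable_of_sufficient_decrease (c := 1 / (B + 1)) (by positivity) (mul_nonneg hC hD)
      hγ hγ1 hr0 (fun k => norm_nonneg _) (fun k => ?_) hkl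
    have h1 := hdec k
    have h2 : 0 ≤ r k - r (k + 1) := by
      simp only [hr]
      have := hmono (show k + 1 ≤ k + 1 + 1 by omega)
      simp only at this
      linarith
    rw [div_mul_eq_mul_div, one_mul, div_le_iff₀ (by positivity)]
    linarith
  have hcauchy : CauchySeq fun k => Q (k + 1) := by
    refine cauchySeq_of_summable_dist (hsum.congr fun k => ?_)
    rw [dist_eq_norm, norm_sub_rev]
  obtain ⟨Z, hZt⟩ := cauchySeq_tendsto_of_complete hcauchy
  have hQt : Tendsto Q atTop (𝓝 Z) := (tendsto_add_atTop_iff_nat 1).1 hZt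
  have hZ : Z ∈ feasibleCov K N := isClosed_feasibleCov.mem_of_tendsto hQt (.of_forall hf)
  have het : Tendsto (fun k => S.ee T (Q k)) atTop (𝓝 (S.ee T Z)) :=
    ((continuousOn_ee (T := T) hη hp Z hZ).tendsto).comp
      (tendsto_nhdsWithin_iff.2 ⟨hQt, .of_forall hf⟩)
  refine ⟨Z, hZ, hQt, het, fun P hP => (hmax P hP).trans ?_⟩
  -- The gap is at most C d(k) ‖Q(k+2) - Qm‖; the lengths tend to 0 and the distances converge, so
  -- the limiting gap is 0.
  have hrt : Tendsto (fun k => r (k + 1)) atTop (𝓝 (S.ee T Qm - S.ee T Z)) :=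
    tendsto_const_nhds.sub (het.comp (tendsto_add_atTop_nat 2))
  have hbound : Tendsto (fun k => C * d k * ‖Q (k + 2) - Qm‖) atTop
      (𝓝 (C * 0 * ‖Z - Qm‖)) :=
    (hsum.tendsto_atTop_zero.const_mul C).mul
      (((hQt.comp (tendsto_add_atTop_nat 2)).sub tendsto_const_nhds).norm)
  have h1 := le_of_tendsto_of_tendsto hrt hbound (.of_forall fun k =>
    hgap _ (hf (k + 1)) _ (hQ (k + 1)) Qm hQm rfl)
  rw [mul_zero, zero_mul] at h1
  linarith

end MIMOBC

end Convergence

theorem MIMOBC.IsIterativeWaterfilling.mem_feasibleCov {K N M : ℕ} {S : MIMOBC K N M}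
    {T : Finset (Fin M)} {Q₀ : CovTuple K N} (hQ₀ : Q₀ ∈ feasibleCov K N)
    {Q : ℕ → CovTuple K N} (hQ : S.IsIterativeWaterfilling T Q₀ Q) (k : ℕ) :
    Q k ∈ feasibleCov K N := by
  cases k with
  | zero => exact hQ.1 ▸ hQ₀
  | succ k => exact IsSweep.mem_feasibleCov (hQ.2 k)

theorem MIMOBC.existsUnique_isIterativeWaterfilling {K N M : ℕ} {S : MIMOBC K N M}
    {T : Finset (Fin M)} (hσ : 0 < S.σ) (hW : 0 < S.W) (hη : 0 < S.η) (hp : 0 < S.fixedPower T)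
    (hH : ∀ i, S.activeH T i ≠ 0) {Q₀ : CovTuple K N} (hQ₀ : Q₀ ∈ feasibleCov K N) :
    ∃! Q : ℕ → CovTuple K N, S.IsIterativeWaterfilling T Q₀ Q := by
  choose f hf using fun Q : feasibleCov K N => exists_isSweep hσ hW hη hp hH Q.2
  let F : ℕ → feasibleCov K N :=
    fun k => Nat.rec ⟨Q₀, hQ₀⟩ (fun _ Q => ⟨f Q, (hf Q).mem_feasibleCov⟩) k
  have hF : S.IsIterativeWaterfilling T Q₀ fun k => (F k).1 := ⟨rfl, fun k => hf (F k)⟩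
  refine ⟨_, hF, fun Q hQ => funext fun k => ?_⟩
  induction k with
  | zero => exact hQ.1
  | succ k ih =>
    have h1 : S.IsSweep T (Q k) (Q (k + 1)) := hQ.2 k
    rw [ih] at h1
    exact h1.unique hσ hW hη hp hH (F k).2 (hF.2 k)

theorem mainTheorem1 {K N M : ℕ} (S : MIMOBC K N M) (T : Finset (Fin M))
    (hσ : 0 < S.σ) (hW : 0 < S.W) (hη : 0 < S.η) (hP : 0 < S.fixedPower T)
    (hH : ∀ i, S.activeH T i ≠ 0) :
    (∀ Q ∈ feasibleCov K N, ∀ i : Fin K,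
      ∃! A : Matrix (Fin N) (Fin N) ℂ, S.IsBlockMaximizer T i Q A) ∧
    ∀ Q₀ ∈ feasibleCov K N,
      (∃! Q : ℕ → CovTuple K N, S.IsIterativeWaterfilling T Q₀ Q) ∧
      ∀ Q : ℕ → CovTuple K N, S.IsIterativeWaterfilling T Q₀ Q →
        (∀ (k : ℕ) (i : Fin K),
          S.ee T (midSweep (Q k) (Q (k + 1)) i) ≤ S.ee T (midSweep (Q k) (Q (k + 1)) (i + 1))) ∧
        Monotone (fun k => S.ee T (Q k)) ∧
        ∃ Qlim ∈ feasibleCov K N,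
          Tendsto Q atTop (𝓝 Qlim) ∧
          Tendsto (fun k => S.ee T (Q k)) atTop (𝓝 (S.ee T Qlim)) ∧
          IsMaxOn (S.ee T) (feasibleCov K N) Qlim := by
  refine ⟨fun Q hQ i => ?_, fun Q₀ hQ₀ =>
    ⟨MIMOBC.existsUnique_isIterativeWaterfilling hσ hW hη hP hH hQ₀, fun Q hQ => ?_⟩⟩
  · obtain ⟨A, hA⟩ := MIMOBC.exists_isBlockMaximizer hσ hW hη hP hH hQ i
    exact ⟨A, hA, fun B hB => hB.unique hσ hW hη hP hH hQ hA⟩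
  have hf := hQ.mem_feasibleCov hQ₀
  have hs : ∀ k, S.IsSweep T (Q k) (Q (k + 1)) := hQ.2
  refine ⟨fun k i => (hs k).ee_midSweep_le (hf k) i,
    monotone_nat_of_le_succ fun k => (hs k).ee_le (hf k), ?_⟩
  -- Without users there is only one tuple; otherwise some user makes a positive `ee` attainable.
  rcases isEmpty_or_nonempty (Fin K) with hK | ⟨⟨i⟩⟩
  · have hconst : Q = fun _ => Q₀ := Subsingleton.elim _ _
    subst hconst
    exact ⟨Q₀, hQ₀, tendsto_const_nhds, tendsto_const_nhds, fun P _ =>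
      (congrArg (S.ee T) (Subsingleton.elim P Q₀)).le⟩
  · obtain ⟨Z, hZ, h1, h2, h3⟩ :=
      MIMOBC.exists_tendsto_of_isSweep hσ hW hη hP hH i (hf 0) hs
    exact ⟨Z, hZ, h1, h2, h3⟩
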